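/- Let $d\ge 1$, let $M_d$ be the algebra of complex $d\times d$ matrices, let $(\Omega,\mathcal F,\mu)$ be a probability space, let $\theta:\Omega\to\Omega$ be an invertible (with measurable inverse) ergodic $\mu$-preserving transformation, and let $\omega\mapsto\phi_\omega$ be a measurable map from $\Omega$ to the set of quantum channels on $M_d$ (completely positive trace-preserving linear maps $M_d\to M_d$). Let $\Phi=(\phi_{\theta^n(\omega)})_n$ be the ergodic quantum process defined by $(\theta,\phi)$. A random projection is a measurable $p:\Omega\to M_d$ with $p_\omega=p_\omega^2=p_\omega^*$ almost surely that is not almost surely $0$. It reduces $\Phi$ if $\phi_{\theta(\omega)}(p_\omega M_d\,p_\omega)\subseteq p_{\theta(\omega)}M_d\,p_{\theta(\omega)}$ for a.e. $\omega$. The process $\Phi$ is irreducible if the only random projection reducing it is $p=\mathbb I$ (almost surely). Let $\Lambda_\Phi$ be the set of $\alpha\in\mathbb C$ with $|\alpha|=1$ for which there is a measurable $x:\Omega\to M_d$, not almost surely zero, with $\phi_{\theta(\omega)}(x_\omega)=\alpha x_{\theta(\omega)}$ for a.e. $\omega$. Let $\Lambda_\theta$ be the set of $\beta\in\mathbb C$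 for which there is a measurable $f:\Omega\to\mathbb C$, not almost surely zero, with $f\circ\theta=\beta f$ almost surely. The set $\Lambda_\theta$ is called torsion if every $\beta\in\Lambda_\theta$ satisfies $\beta^n=1$ for some integer $n\ge1$. **Corollary.** Assume that $\Phi$ is irreducible. If $\Lambda_\theta$ is torsion, then $\Lambda_\Phi$ and $\Lambda_\theta\subseteq\Lambda_\Phi$ are groups under multiplication, and the quotient group $\Gamma_\Phi=\Lambda_\Phi/\Lambda_\theta$ is cyclic and finite with $|\Gamma_\Phi|\le d$. The hypothesis that $\Lambda_\theta$ is torsion holds in particular if $\theta$ is weakly mixing, i.e. if $\lim_{N\to\infty}\frac1N\sum_{n=1}^N|\mu(\theta^{-n}(A)\cap B)-\mu(A)\mu(B)|=0$ for all $A,B\in\mathcal F$. The bound is sharp for every $d\ge 1$: let $\Omega$ be the one-point probability space, $\theta$ the identity, $e_1,\dots,e_d$ the standard basis of $\mathbb C^d$, and let $\phi$ be constantly equal to $\psi(a)=\sum_{i=1}^d v_i a v_i^*$, where $v_i=|e_i\rangle\langle e_{i+1}|$ for $i<d$ and $v_d=|e_d\rangle\langle e_1|$. Then $(\theta,\phi)$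 defines an irreducible ergodic quantum process, $\Lambda_\theta$ is torsion, and $\Gamma_\Phi$ is cyclic of order exactly $d$. -/

import Mathlib

open MeasureTheory Filter Topology
open scoped Matrix ComplexOrder

universe u

/-- The `d × d` complex matrices. -/
abbrev Mat (d : ℕ) : Type := Matrix (Fin d) (Fin d) ℂ

/-- The amplification `ψ ⊗ id` of a linear map `ψ` on `d × d` matrices to `d × d` block matrices
with blocks indexed by `Fin k`: apply `ψ` to every `d × d` block. -/
def amplify {d : ℕ} (ψ : Mat d →ₗ[ℂ] Mat d) (k : ℕ)
    (X : Matrix (Fin d × Fin k) (Fin d × Fin k) ℂ) :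
    Matrix (Fin d × Fin k) (Fin d × Fin k) ℂ :=
  Matrix.of fun a b =>
    ψ (Matrix.of fun i j => X (i, a.2) (j, b.2)) a.1 b.1

/-- Complete positivity of a linear map on `d × d` matrices. -/
def IsCompletelyPositive {d : ℕ} (ψ : Mat d →ₗ[ℂ] Mat d) : Prop :=
  ∀ (k : ℕ) (X : Matrix (Fin d × Fin k) (Fin d × Fin k) ℂ),
    X.PosSemidef → (amplify ψ k X).PosSemidef

/-- A quantum channel is a completely positive, trace-preserving linear map. -/
structure IsQuantumChannel {d : ℕ} (ψ : Mat d →ₗ[ℂ] Mat d) : Prop where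
  completelyPositive : IsCompletelyPositive ψ
  trace_preserving : ∀ a : Mat d, (ψ a).trace = a.trace

/-- Measurability of a matrix-valued function (entrywise). -/
def MeasurableMat {Ω : Type u} [MeasurableSpace Ω] {d : ℕ} (x : Ω → Mat d) : Prop :=
  ∀ i j, Measurable fun ω => x ω i j

/-- The pair `(θ, φ)` defines an ergodic quantum process `φ ∘ θ ^ n`: `θ` is an invertible ergodic
measure-preserving transformation and `φ` is a measurable function with values in the quantum
channels. -/
structure IsErgodicQuantumProcess {Ω : Type u} [MeasurableSpace Ω] {d : ℕ} (μ : Measure Ω)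
    (θ : Ω ≃ᵐ Ω) (φ : Ω → Mat d →ₗ[ℂ] Mat d) : Prop where
  ergodic : Ergodic θ μ
  measurable : ∀ a : Mat d, MeasurableMat fun ω => φ ω a
  channel : ∀ ω, IsQuantumChannel (φ ω)

/-- A random projection: a measurable matrix-valued function whose values are almost surely
orthogonal projections (`p = p ^ 2 = pᴴ`) and which is not almost surely zero. -/
structure IsRandomProjection {Ω : Type u} [MeasurableSpace Ω] {d : ℕ} (μ : Measure Ω)
    (p : Ω → Mat d) : Prop where
  measurable : MeasurableMat p
  isStarProjection : ∀ᵐ ω ∂μ, IsStarProjection (p ω)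
  ne_zero : ¬ ∀ᵐ ω ∂μ, p ω = 0

/-- The corner `p M p` of the matrix algebra. -/
def corner {d : ℕ} (p : Mat d) : Set (Mat d) := {b | ∃ a : Mat d, b = p * a * p}

/-- `p` reduces the process: `φ_{θ ω} (p_ω M p_ω) ⊆ p_{θ ω} M p_{θ ω}` for almost every `ω`. -/
def Reduces {Ω : Type u} [MeasurableSpace Ω] {d : ℕ} (μ : Measure Ω)
    (θ : Ω ≃ᵐ Ω) (φ : Ω → Mat d →ₗ[ℂ] Mat d) (p : Ω → Mat d) : Prop :=
  ∀ᵐ ω ∂μ, φ (θ ω) '' corner (p ω) ⊆ corner (p (θ ω))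

/-- The process is irreducible: the only random projection that reduces it is the identity. -/
def IsIrreducibleProcess {Ω : Type u} [MeasurableSpace Ω] {d : ℕ} (μ : Measure Ω)
    (θ : Ω ≃ᵐ Ω) (φ : Ω → Mat d →ₗ[ℂ] Mat d) : Prop :=
  ∀ p : Ω → Mat d, IsRandomProjection μ p → Reduces μ θ φ p → ∀ᵐ ω ∂μ, p ω = 1

/-- The peripheral eigenvalues of the process: those `α` with `|α| = 1` for which some random matrix
`x`, not almost surely zero, satisfies `φ_{θ ω} (x_ω) = α x_{θ ω}` for almost every `ω`. -/
def peripheralEigenvalues {Ω : Type u} [MeasurableSpace Ω] {d : ℕ} (μ : Measure Ω)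
    (θ : Ω ≃ᵐ Ω) (φ : Ω → Mat d →ₗ[ℂ] Mat d) : Set ℂ :=
  {α | ‖α‖ = 1 ∧ ∃ x : Ω → Mat d, MeasurableMat x ∧ (¬ ∀ᵐ ω ∂μ, x ω = 0) ∧
    ∀ᵐ ω ∂μ, φ (θ ω) (x ω) = α • x (θ ω)}

/-- The eigenvalues of `θ`: those `β` for which some measurable function `f`, not almost surely
zero, satisfies `f ∘ θ = β f` almost surely. -/
def koopmanEigenvalues {Ω : Type u} [MeasurableSpace Ω] (μ : Measure Ω) (θ : Ω ≃ᵐ Ω) : Set ℂ :=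
  {β | ∃ f : Ω → ℂ, Measurable f ∧ (¬ ∀ᵐ ω ∂μ, f ω = 0) ∧ ∀ᵐ ω ∂μ, f (θ ω) = β * f ω}

/-- Every element of the set has finite multiplicative order. -/
def IsTorsionSet (Λ : Set ℂ) : Prop := ∀ β ∈ Λ, ∃ n : ℕ, 0 < n ∧ β ^ n = 1

/-- `θ` is weakly mixing. -/
def IsWeaklyMixing {Ω : Type u} [MeasurableSpace Ω] (μ : Measure Ω) (θ : Ω ≃ᵐ Ω) : Prop :=
  ∀ A B : Set Ω, MeasurableSet A → MeasurableSet B →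
    Tendsto (fun N : ℕ => (N : ℝ)⁻¹ * ∑ n ∈ Finset.Icc 1 N,
      |μ.real ((θ^[n]) ⁻¹' A ∩ B) - μ.real A * μ.real B|) atTop (𝓝 0)

/-- The set `Λ` of complex numbers is the subgroup `G` of the multiplicative group of `ℂ`. -/
def IsSubgroupOfUnits (G : Subgroup ℂˣ) (Λ : Set ℂ) : Prop :=
  ((↑) : ℂˣ → ℂ) '' (G : Set ℂˣ) = Λ

/-- The cyclic shift channel `a ↦ ∑ i, v i * a * (v i)ᴴ`, where `v i` is the matrix unit
`|e_i⟩⟨e_{i+1}|`, indices being read cyclically. -/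
def shiftChannel (d : ℕ) : Mat d →ₗ[ℂ] Mat d where
  toFun a := ∑ i : Fin d,
    (Matrix.single i (finRotate d i) 1 : Mat d) * a * (Matrix.single i (finRotate d i) 1 : Mat d)ᴴ
  map_add' a b := by simp [mul_add, add_mul, Finset.sum_add_distrib]
  map_smul' c a := by simp [Finset.smul_sum]

/-! ### Positivity of block matrices under completely positive maps -/

/-! Everything is measured against a faithful stationary state `ρ`. The operator `x ↦ (ω ↦ φ_ω
(x_{θ⁻¹ω}))` on `L²` preserves the closed convex bounded set of state-valued functions, so it has a
fixed point there (`exists_invariant_state`). The support projection of a positive fixed point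
reduces the process, so irreducibility makes every nonzero positive fixed point invertible
(`ae_posDef`); a maximal-subtraction argument then makes it a scalar multiple of `ρ`
(`exists_eq_smul`).

For an eigenmatrix `x` with `|α| = 1`, the Lieb–Ruskai inequality says that `tr (x ρ⁻¹ xᴴ)` does not
decrease along orbits. Ergodicity makes it constant, hence the inequality is an equality, `x ρ⁻¹ xᴴ`
is a positive fixed point, and `x` is invertible. Polarizing the equality shows that `x ρ⁻¹ z` is an
eigenmatrix for `αβ`, so the peripheral eigenvalues form a group.

Since channels preserve the trace, the trace of an eigenmatrix for `α ^ k` is, unless it vanishes,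
an eigenfunction of `θ` for `α⁻ᵏ`. By Cayley–Hamilton the traces of `(x ρ⁻¹) ^ k ρ` with `1 ≤ k ≤ d`
cannot all vanish, so each class in the quotient has order at most `d`. If `Λ_θ` is torsion, all
peripheral eigenvalues are roots of unity, any two of them lie in a common cyclic subgroup, and an
element of maximal order generates the quotient.

Under weak mixing an eigenfunction for `β ≠ 1` would have correlations of constant modulus whose
averages tend to zero. For the shift channel the peripheral eigenvalues are exactly the `d`-th roots
of unity. -/

theorem IsCompletelyPositive.fromBlocks {d : ℕ} {ψ : Mat d →ₗ[ℂ] Mat d}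
    (hψ : IsCompletelyPositive ψ) {A B C D : Mat d}
    (h : (Matrix.fromBlocks A B C D).PosSemidef) :
    (Matrix.fromBlocks (ψ A) (ψ B) (ψ C) (ψ D)).PosSemidef := by
  have h1 := (hψ 2 _ (h.submatrix
    (fun a : Fin d × Fin 2 => if a.2 = 0 then Sum.inl a.1 else Sum.inr a.1))).submatrix
    (Sum.elim (fun i => (i, 0)) (fun i => (i, 1)) : Fin d ⊕ Fin d → Fin d × Fin 2)
  convert h1 using 1
  ext (i | i) (j | j) <;> simp [amplify] <;> rfl

theorem IsCompletelyPositive.posSemidef {d : ℕ} {ψ : Mat d →ₗ[ℂ] Mat d}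
    (hψ : IsCompletelyPositive ψ) {A : Mat d} (h : A.PosSemidef) : (ψ A).PosSemidef := by
  have h0 : (Matrix.fromBlocks A A A A).PosSemidef := by
    convert h.submatrix (Sum.elim id id : Fin d ⊕ Fin d → Fin d) using 1
    ext (i | i) (j | j) <;> simp
  exact (hψ.fromBlocks h0).submatrix Sum.inl

theorem Matrix.PosSemidef.gram_fromBlocks {d : ℕ} {C : Mat d} (hC : C.PosSemidef) (X Y : Mat d) :
    (Matrix.fromBlocks (X * C * Xᴴ) (X * C * Yᴴ) (Y * C * Xᴴ) (Y * C * Yᴴ)).PosSemidef := by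
  have h := hC.mul_mul_conjTranspose_same (Matrix.fromRows X Y)
  rwa [Matrix.conjTranspose_fromRows_eq_fromCols_conjTranspose, Matrix.fromRows_mul,
    Matrix.fromRows_mul_fromCols] at h

theorem IsCompletelyPositive.map_conjTranspose {d : ℕ} {ψ : Mat d →ₗ[ℂ] Mat d}
    (hψ : IsCompletelyPositive ψ) (B : Mat d) : ψ Bᴴ = (ψ B)ᴴ := by
  have h := (hψ.fromBlocks (Matrix.PosSemidef.one.gram_fromBlocks B 1)).1
  rw [Matrix.isHermitian_fromBlocks_iff] at h
  simpa using h.2.1.symm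

/-- If `D v = 0`, the quadratic form vanishes at `(0, v)`, so positivity puts this vector in the
kernel of the block matrix; its upper component gives `B v = 0`. -/
theorem Matrix.PosSemidef.mul_eq_zero_of_fromBlocks {d : ℕ} {A B C D : Mat d}
    (h : (Matrix.fromBlocks A B C D).PosSemidef) {q : Mat d} (hq : D * q = 0) : B * q = 0 := by
  have key : ∀ v : Fin d → ℂ, D *ᵥ v = 0 → B *ᵥ v = 0 := by
    intro v hv
    have h1 := (h.dotProduct_mulVec_zero_iff (Sum.elim 0 v)).1 (by
      rw [Matrix.fromBlocks_mulVec]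
      simp [dotProduct, hv])
    rw [Matrix.fromBlocks_mulVec] at h1
    ext i
    simpa using congrFun h1 (Sum.inl i)
  ext i j
  have := key (fun k => q k j) (by
    ext k; simpa [Matrix.mul_apply, Matrix.mulVec, dotProduct] using congrFun (congrFun hq k) j)
  simpa [Matrix.mul_apply, Matrix.mulVec, dotProduct] using congrFun this i

/-- The Lieb–Ruskai form of the Schwarz inequality. -/
theorem IsCompletelyPositive.schwarz {d : ℕ} {ψ : Mat d →ₗ[ℂ] Mat d}
    (hψ : IsCompletelyPositive ψ) {ρ : Mat d} (hρ : ρ.PosDef) (hρ' : (ψ ρ).PosDef) (x : Mat d) :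
    (ψ (x * ρ⁻¹ * xᴴ) - ψ x * (ψ ρ)⁻¹ * (ψ x)ᴴ).PosSemidef := by
  have hu := (Matrix.isUnit_iff_isUnit_det _).1 hρ.isUnit
  -- The Gram block matrix with rows `x ρ⁻¹ xᴴ, x` and `xᴴ, ρ` stays positive under `ψ`; the
  -- inequality is its Schur complement.
  have h := hψ.fromBlocks (hρ.inv.posSemidef.gram_fromBlocks x ρ)
  rw [hρ.isHermitian.eq, Matrix.mul_nonsing_inv _ hu, Matrix.one_mul, Matrix.one_mul,
    Matrix.nonsing_inv_mul_cancel_right _ _ hu, hψ.map_conjTranspose] at h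
  have := hρ'.isUnit.invertible
  exact (Matrix.PosDef.fromBlocks₂₂ _ _ hρ').1 h

/-- If the Schwarz inequality is an equality at `x` and at `z`, then it polarizes to an equality. -/
theorem IsCompletelyPositive.schwarz_eq {d : ℕ} {ψ : Mat d →ₗ[ℂ] Mat d}
    (hψ : IsCompletelyPositive ψ) {ρ : Mat d} (hρ : ρ.PosDef) (hρ' : (ψ ρ).PosDef) {x z : Mat d}
    (hx : ψ (x * ρ⁻¹ * xᴴ) = ψ x * (ψ ρ)⁻¹ * (ψ x)ᴴ)
    (hz : ψ (z * ρ⁻¹ * zᴴ) = ψ z * (ψ ρ)⁻¹ * (ψ z)ᴴ) :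
    ψ (x * ρ⁻¹ * zᴴ) = ψ x * (ψ ρ)⁻¹ * (ψ z)ᴴ := by
  set D : Mat d → Mat d → Mat d := fun a b => ψ (a * ρ⁻¹ * bᴴ) - ψ a * (ψ ρ)⁻¹ * (ψ b)ᴴ with hD
  -- At `x + t z` the diagonal terms of the defect vanish. What remains is real-linear in `t`, so
  -- positivity at `t` and `-t` forces it to be zero.
  have hexp : ∀ t : ℂ, (star t • D x z + t • D z x).PosSemidef := by
    intro t
    have h := hψ.schwarz hρ hρ' (x + t • z)
    convert h using 1
    simp only [hD, map_add, map_smul, Matrix.conjTranspose_add, Matrix.conjTranspose_smul,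
      Matrix.add_mul, Matrix.mul_add, Matrix.smul_mul, Matrix.mul_smul, hx, hz, smul_add, smul_sub]
    abel
  have hzero : ∀ t : ℂ, star t • D x z + t • D z x = 0 := by
    intro t
    have h1 := hexp t
    have h2 := hexp (-t)
    have h3 : (star (-t) • D x z + -t • D z x) = -(star t • D x z + t • D z x) := by
      simp only [star_neg, neg_smul, neg_add]
    rw [h3] at h2
    rw [← h1.trace_eq_zero_iff]
    have h4 := h2.trace_nonneg
    rw [Matrix.trace_neg] at h4
    exact le_antisymm (neg_nonneg.1 h4) h1.trace_nonneg
  have h1 := hzero 1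
  have h2 := hzero Complex.I
  simp only [star_one, one_smul] at h1
  have h3 : D z x = - D x z := (neg_eq_of_add_eq_zero_right h1).symm
  rw [h3] at h2
  have h4 : D x z = 0 := by
    have : (-2 * Complex.I) • D x z = 0 := by
      rw [← h2]; simp only [Complex.star_def, Complex.conj_I]; module
    exact (smul_eq_zero.1 this).resolve_left (by simp)
  exact sub_eq_zero.1 h4

/-! ### Support projections -/

/-- Diagonalize and work on eigenvalues. The limit formula is included because it makes the support
projection of a random matrix measurable. -/
theorem Matrix.PosSemidef.exists_support {d : ℕ} {z : Mat d} (hz : z.PosSemidef) :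
    ∃ p g : Mat d, Tendsto (fun n : ℕ => z * (z + ((n : ℂ) + 1)⁻¹ • (1 : Mat d))⁻¹) atTop (𝓝 p) ∧
      IsStarProjection p ∧ p * z = z ∧ p = z * g := by
  set U : Mat d := hz.1.eigenvectorUnitary.1 with hU
  have hUU : Uᴴ * U = 1 := Matrix.mem_unitaryGroup_iff'.1 hz.1.eigenvectorUnitary.2
  have hUU' : U * Uᴴ = 1 := Matrix.mem_unitaryGroup_iff.1 hz.1.eigenvectorUnitary.2
  set l : Fin d → ℝ := hz.1.eigenvalues with hl
  have hl0 : ∀ i, 0 ≤ l i := hz.eigenvalues_nonneg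
  have hzU : z = U * Matrix.diagonal (fun i => (l i : ℂ)) * Uᴴ := by
    have := hz.1.spectral_theorem
    rwa [Unitary.conjStarAlgAut_apply] at this
  have hconj : ∀ a b : Fin d → ℂ, (U * Matrix.diagonal a * Uᴴ) * (U * Matrix.diagonal b * Uᴴ) =
      U * Matrix.diagonal (a * b) * Uᴴ := by
    intro a b
    calc _ = U * Matrix.diagonal a * (Uᴴ * U) * Matrix.diagonal b * Uᴴ := by noncomm_ring
      _ = _ := by
        rw [hUU, Matrix.mul_one, Matrix.mul_assoc U, Matrix.diagonal_mul_diagonal]; rfl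
  set s : Fin d → ℂ := fun i => if l i = 0 then 0 else 1 with hs
  -- The second witness is the pseudo-inverse of `z`, thanks to the convention `0⁻¹ = 0`.
  refine ⟨U * Matrix.diagonal s * Uᴴ, U * Matrix.diagonal (fun i => (l i : ℂ)⁻¹) * Uᴴ,
    ?_, ⟨?_, ?_⟩, ?_, ?_⟩
  · have hform : ∀ n : ℕ, z * (z + ((n : ℂ) + 1)⁻¹ • (1 : Mat d))⁻¹ =
        U * Matrix.diagonal (fun i => (l i : ℂ) * ((l i : ℂ) + ((n : ℂ) + 1)⁻¹)⁻¹) * Uᴴ := by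
      intro n
      have hne : ∀ i, (l i : ℂ) + ((n : ℂ) + 1)⁻¹ ≠ 0 := by
        intro i
        have h1 : (0 : ℝ) < l i + ((n : ℝ) + 1)⁻¹ := by
          have := hl0 i; positivity
        have h2 : ((l i + ((n : ℝ) + 1)⁻¹ : ℝ) : ℂ) ≠ 0 := Complex.ofReal_ne_zero.2 h1.ne'
        simpa using h2
      have h1 : z + ((n : ℂ) + 1)⁻¹ • (1 : Mat d) =
          U * Matrix.diagonal (fun i => (l i : ℂ) + ((n : ℂ) + 1)⁻¹) * Uᴴ := by
        have h2 : Matrix.diagonal (fun i => (l i : ℂ) + ((n : ℂ) + 1)⁻¹) =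
            Matrix.diagonal (fun i => (l i : ℂ)) + ((n : ℂ) + 1)⁻¹ • (1 : Mat d) := by
          rw [← Matrix.diagonal_one, ← Matrix.diagonal_smul, Matrix.diagonal_add]
          congr 1; ext i; simp
        rw [h2, Matrix.mul_add, Matrix.add_mul, ← hzU]
        simp [hUU']
      have h2 : (z + ((n : ℂ) + 1)⁻¹ • (1 : Mat d))⁻¹ =
          U * Matrix.diagonal (fun i => ((l i : ℂ) + ((n : ℂ) + 1)⁻¹)⁻¹) * Uᴴ := by
        apply Matrix.inv_eq_right_inv
        rw [h1, hconj]
        have h3 : ((fun i => (l i : ℂ) + ((n : ℂ) + 1)⁻¹) *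
            fun i => ((l i : ℂ) + ((n : ℂ) + 1)⁻¹)⁻¹) = 1 := by
          ext i; exact mul_inv_cancel₀ (hne i)
        rw [h3]
        simp [hUU']
      rw [h2]
      nth_rw 1 [hzU]
      rw [hconj]; rfl
    simp_rw [hform]
    have hlim : Tendsto (fun n : ℕ => (fun i => (l i : ℂ) * ((l i : ℂ) + ((n : ℂ) + 1)⁻¹)⁻¹))
        atTop (𝓝 s) := by
      rw [tendsto_pi_nhds]
      intro i
      by_cases h : l i = 0
      · simp [hs, h]
      · have hc : (l i : ℂ) ≠ 0 := by exact_mod_cast h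
        have h0 : Tendsto (fun n : ℕ => ((n : ℂ) + 1)⁻¹) atTop (𝓝 0) := by
          simpa using tendsto_one_div_add_atTop_nhds_zero_nat (𝕜 := ℂ)
        have h1 := ((h0.const_add (l i : ℂ)).inv₀ (by simpa using hc)).const_mul (l i : ℂ)
        simpa [hs, h, hc] using h1
    have hcont : Continuous fun a : Fin d → ℂ => U * Matrix.diagonal a * Uᴴ := by fun_prop
    exact (hcont.tendsto s).comp hlim
  · show _ * _ = _
    rw [hconj]
    congr 3; ext i; simp [hs]
  · show (_)ᴴ = _
    rw [Matrix.conjTranspose_mul, Matrix.conjTranspose_mul, Matrix.conjTranspose_conjTranspose,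
      Matrix.diagonal_conjTranspose, ← Matrix.mul_assoc]
    congr 3; ext i; by_cases h : l i = 0 <;> simp [hs, h]
  · nth_rw 1 [hzU]
    rw [hconj]
    refine Eq.trans ?_ hzU.symm
    congr 3; ext i; by_cases h : l i = 0 <;> simp [hs, h]
  · nth_rw 1 [hzU]
    rw [hconj]
    congr 3; ext i; by_cases h : l i = 0 <;> simp [hs, h]

/-- A positive map sends the corner of the support of `z` to the corner of any projection that
dominates the image of `z`. -/
theorem IsCompletelyPositive.image_corner_subset {d : ℕ} {ψ : Mat d →ₗ[ℂ] Mat d}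
    (hψ : IsCompletelyPositive ψ) {z p g p' : Mat d} (hz : z.PosSemidef) (hp : IsStarProjection p)
    (hpg : p = z * g) (hp' : IsStarProjection p') (hp'z : p' * ψ z = ψ z) :
    ψ '' corner p ⊆ corner p' := by
  have hz' : ψ z * p' = ψ z := by
    have h := congrArg Matrix.conjTranspose hp'z
    rw [Matrix.conjTranspose_mul, (hψ.posSemidef hz).1.eq] at h
    rwa [show p'ᴴ = p' from hp'.2] at h
  -- Here `ψ z` is the lower diagonal block, with `ψ z * (1 - p') = 0`, and `ψ (cᴴ * z)` is the
  -- block above it.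
  have hright : ∀ c : Mat d, ψ (cᴴ * z) * p' = ψ (cᴴ * z) := by
    intro c
    have h := hψ.fromBlocks (hz.gram_fromBlocks cᴴ 1)
    have h2 := Matrix.PosSemidef.mul_eq_zero_of_fromBlocks h (q := 1 - p')
      (by simp [Matrix.mul_sub, hz'])
    simp only [Matrix.conjTranspose_one, Matrix.mul_one, Matrix.mul_sub] at h2
    exact (sub_eq_zero.1 h2).symm
  have hleft : ∀ c : Mat d, p' * ψ (z * c) = ψ (z * c) := by
    intro c
    have h := congrArg Matrix.conjTranspose (hright c)
    rw [Matrix.conjTranspose_mul, ← hψ.map_conjTranspose, Matrix.conjTranspose_mul,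
      Matrix.conjTranspose_conjTranspose, hz.1.eq] at h
    rwa [show p'ᴴ = p' from hp'.2] at h
  have hpg' : p = gᴴ * z := by
    have h := congrArg Matrix.conjTranspose hpg
    rw [Matrix.conjTranspose_mul, hz.1.eq] at h
    rwa [show pᴴ = p from hp.2] at h
  rintro _ ⟨_, ⟨a, rfl⟩, rfl⟩
  refine ⟨ψ (p * a * p), ?_⟩
  have h1 : p' * ψ (p * a * p) = ψ (p * a * p) := by
    have : p * a * p = z * (g * a * p) := by rw [← Matrix.mul_assoc, ← Matrix.mul_assoc, ← hpg]
    rw [this, hleft]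
  have h2 : ψ (p * a * p) * p' = ψ (p * a * p) := by
    have h := hright ((p * a * gᴴ)ᴴ)
    rwa [Matrix.conjTranspose_conjTranspose, Matrix.mul_assoc, ← hpg'] at h
  rw [h1, h2]

/-! ### Spectral shifts -/

theorem Matrix.IsHermitian.posSemidef_add_smul_one {d : ℕ} {A : Mat d} (hA : A.IsHermitian)
    {c : ℝ} (hc : ∀ i, 0 ≤ hA.eigenvalues i + c) : (A + (c : ℂ) • (1 : Mat d)).PosSemidef := by
  set U : Mat d := hA.eigenvectorUnitary.1 with hU
  have hUU' : U * Uᴴ = 1 := Matrix.mem_unitaryGroup_iff.1 hA.eigenvectorUnitary.2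
  have hAU : A = U * Matrix.diagonal (fun i => (hA.eigenvalues i : ℂ)) * Uᴴ := by
    have := hA.spectral_theorem
    rwa [Unitary.conjStarAlgAut_apply] at this
  have h2 : Matrix.diagonal (fun i => ((hA.eigenvalues i + c : ℝ) : ℂ)) =
      Matrix.diagonal (fun i => (hA.eigenvalues i : ℂ)) + (c : ℂ) • (1 : Mat d) := by
    rw [← Matrix.diagonal_one, ← Matrix.diagonal_smul, Matrix.diagonal_add]
    congr 1; ext i; simp
  have h3 : A + (c : ℂ) • (1 : Mat d) =
      U * Matrix.diagonal (fun i => ((hA.eigenvalues i + c : ℝ) : ℂ)) * Uᴴ := by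
    rw [h2, Matrix.mul_add, Matrix.add_mul, ← hAU]
    simp [hUU']
  rw [h3]
  refine (Matrix.PosSemidef.diagonal ?_).mul_mul_conjTranspose_same U
  intro i
  show (0 : ℂ) ≤ ((hA.eigenvalues i + c : ℝ) : ℂ)
  exact_mod_cast hc i

/-- With `z ≥ ε` and `y ≤ C`, any `n` with `C / ε < n` works. Reciprocals of integers are used so
that only countably many null sets arise later. -/
theorem Matrix.PosDef.exists_sub_smul_posSemidef {d : ℕ} {z y : Mat d} (hz : z.PosDef)
    (hy : y.PosSemidef) :
    ∃ n : ℕ, (z - (((n : ℝ) + 1)⁻¹ : ℝ) • y).PosSemidef := by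
  obtain ⟨ε, hε, h1⟩ : ∃ ε : ℝ, 0 < ε ∧ ∀ i, ε ≤ hz.1.eigenvalues i := by
    rcases isEmpty_or_nonempty (Fin d) with h | h
    · exact ⟨1, one_pos, fun i => h.elim i⟩
    · obtain ⟨i, hi⟩ := Finite.exists_min hz.1.eigenvalues
      exact ⟨_, hz.eigenvalues_pos i, hi⟩
  have hz' := hz.1.posSemidef_add_smul_one (c := -ε) (fun i => by linarith [h1 i])
  set C : ℝ := ∑ i, |hy.1.neg.eigenvalues i| with hC
  have hC0 : 0 ≤ C := Finset.sum_nonneg fun i _ => abs_nonneg _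
  have hy' := hy.1.neg.posSemidef_add_smul_one (c := C) (fun i => by
    have h2 : |hy.1.neg.eigenvalues i| ≤ C :=
      Finset.single_le_sum (f := fun i => |hy.1.neg.eigenvalues i|)
        (fun i _ => abs_nonneg _) (Finset.mem_univ i)
    have h3 := neg_abs_le (hy.1.neg.eigenvalues i)
    linarith)
  obtain ⟨n, hn⟩ := exists_nat_gt (C / ε)
  refine ⟨n, ?_⟩
  have hn0 : (0 : ℝ) < (n : ℝ) + 1 := by positivity
  have h4 : 0 ≤ ε - ((n : ℝ) + 1)⁻¹ * C := by
    rw [div_lt_iff₀ hε] at hn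
    rw [sub_nonneg, inv_mul_le_iff₀ hn0]
    linarith
  have h5 : z - (((n : ℝ) + 1)⁻¹ : ℝ) • y = (z + ((-ε : ℝ) : ℂ) • (1 : Mat d)) +
      ((((n : ℝ) + 1)⁻¹ : ℝ) • (-y + (C : ℂ) • (1 : Mat d)) +
        (ε - ((n : ℝ) + 1)⁻¹ * C : ℝ) • (1 : Mat d)) := by
    simp only [Complex.coe_smul]
    module
  rw [h5]
  exact hz'.add ((hy'.smul (inv_nonneg.2 hn0.le)).add (Matrix.PosSemidef.one.smul h4))

theorem isClosed_posSemidef (d : ℕ) : IsClosed {A : Mat d | A.PosSemidef} := by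
  have : {A : Mat d | A.PosSemidef} =
      {A | Aᴴ = A} ∩ ⋂ v : Fin d → ℂ, {A | 0 ≤ star v ⬝ᵥ A *ᵥ v} := by
    ext A
    simp [Matrix.posSemidef_iff_dotProduct_mulVec, Matrix.IsHermitian]
  rw [this]
  refine (isClosed_eq (by fun_prop) (by fun_prop)).inter (isClosed_iInter fun v => ?_)
  exact isClosed_le continuous_const (by fun_prop)

/-! ### Measurability of matrix-valued functions -/

section Measurability

variable {Ω : Type u} [MeasurableSpace Ω] {d : ℕ}

theorem MeasurableMat.continuous_comp {x : Ω → Mat d} (hx : MeasurableMat x) {F : Mat d → ℂ}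
    (hF : Continuous F) : Measurable fun ω => F (x ω) := by
  have h1 : Measurable fun ω => (fun i j => x ω i j : Fin d → Fin d → ℂ) :=
    measurable_pi_iff.2 fun i => measurable_pi_iff.2 fun j => hx i j
  have h2 : Continuous fun f : Fin d → Fin d → ℂ => F (Matrix.of f) := hF
  exact h2.measurable.comp h1

theorem MeasurableMat.measurableSet_of_isClosed {x : Ω → Mat d} (hx : MeasurableMat x)
    {s : Set (Mat d)} (hs : IsClosed s) : MeasurableSet {ω | x ω ∈ s} := by
  have h1 : Measurable fun ω => (fun i j => x ω i j : Fin d → Fin d → ℂ) :=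
    measurable_pi_iff.2 fun i => measurable_pi_iff.2 fun j => hx i j
  have h2 : IsClosed {f : Fin d → Fin d → ℂ | Matrix.of f ∈ s} := hs
  exact h1 h2.measurableSet

theorem MeasurableMat.const (a : Mat d) : MeasurableMat fun _ : Ω => a :=
  fun _ _ => measurable_const

theorem MeasurableMat.mul {x y : Ω → Mat d} (hx : MeasurableMat x) (hy : MeasurableMat y) :
    MeasurableMat fun ω => x ω * y ω := by
  intro i j
  simp only [Matrix.mul_apply]
  exact Finset.measurable_sum _ fun k _ => (hx i k).mul (hy k j)

theorem MeasurableMat.add {x y : Ω → Mat d} (hx : MeasurableMat x) (hy : MeasurableMat y) :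
    MeasurableMat fun ω => x ω + y ω := fun i j => (hx i j).add (hy i j)

theorem MeasurableMat.sub {x y : Ω → Mat d} (hx : MeasurableMat x) (hy : MeasurableMat y) :
    MeasurableMat fun ω => x ω - y ω := fun i j => (hx i j).sub (hy i j)

theorem MeasurableMat.smul {f : Ω → ℂ} {x : Ω → Mat d} (hf : Measurable f)
    (hx : MeasurableMat x) : MeasurableMat fun ω => f ω • x ω := fun i j => hf.mul (hx i j)

theorem MeasurableMat.conjTranspose {x : Ω → Mat d} (hx : MeasurableMat x) :
    MeasurableMat fun ω => (x ω)ᴴ := fun i j => Complex.continuous_conj.measurable.comp (hx j i)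

theorem MeasurableMat.trace {x : Ω → Mat d} (hx : MeasurableMat x) :
    Measurable fun ω => (x ω).trace := hx.continuous_comp (by fun_prop)

theorem MeasurableMat.inv {x : Ω → Mat d} (hx : MeasurableMat x) :
    MeasurableMat fun ω => (x ω)⁻¹ := by
  intro i j
  simp only [Matrix.inv_def, Ring.inverse_eq_inv', Matrix.smul_apply, smul_eq_mul]
  exact (hx.continuous_comp (by fun_prop)).inv.mul
    (hx.continuous_comp (F := fun a => a.adjugate i j) (by fun_prop))

theorem MeasurableMat.apply {φ : Ω → Mat d →ₗ[ℂ] Mat d}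
    (hφ : ∀ a : Mat d, MeasurableMat fun ω => φ ω a) {x : Ω → Mat d} (hx : MeasurableMat x) :
    MeasurableMat fun ω => φ ω (x ω) := by
  intro i j
  have h : ∀ ω, φ ω (x ω) i j = ∑ k, ∑ l, x ω k l * φ ω (Matrix.single k l 1) i j := by
    intro ω
    conv_lhs => rw [Matrix.matrix_eq_sum_single (x ω)]
    simp only [map_sum, Matrix.sum_apply]
    refine Finset.sum_congr rfl fun k _ => Finset.sum_congr rfl fun l _ => ?_
    rw [← mul_one (x ω k l), ← smul_eq_mul, ← Matrix.smul_single, map_smul, Matrix.smul_apply]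
    simp
  simp only [h]
  exact Finset.measurable_sum _ fun k _ => Finset.measurable_sum _ fun l _ =>
    (hx k l).mul (hφ _ i j)

end Measurability

/-! ### Ergodicity and monotone functions -/

section Ergodicity

variable {Ω : Type u} [MeasurableSpace Ω] {μ : Measure Ω} [IsProbabilityMeasure μ]

theorem Ergodic.ae_mem_or_ae_notMem_of_ae_imp {f : Ω → Ω} (hf : Ergodic f μ) {s : Set Ω}
    (hs : MeasurableSet s) (h : ∀ᵐ ω ∂μ, ω ∈ s → f ω ∈ s) :
    (∀ᵐ ω ∂μ, ω ∈ s) ∨ ∀ᵐ ω ∂μ, ω ∉ s := by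
  rcases hf.ae_empty_or_univ_of_ae_le_preimage hs.nullMeasurableSet h with h | h
  · right
    filter_upwards [h.mem_iff] with ω hω using by simpa using hω
  · left
    filter_upwards [h.mem_iff] with ω hω using by simpa using hω

/-- Each sublevel set at a rational level is forward invariant, hence null or conull, which rules
out a strict decrease. No integrability is needed. -/
theorem Ergodic.ae_eq_const_of_comp_ae_le {f : Ω → Ω} (hf : Ergodic f μ) {g : Ω → ℝ}
    (hg : Measurable g) (h : ∀ᵐ ω ∂μ, g (f ω) ≤ g ω) : ∃ c, ∀ᵐ ω ∂μ, g ω = c := by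
  have h1 : ∀ᵐ ω ∂μ, ∀ q : ℚ, (g ω ≤ q ↔ g (f ω) ≤ q) := by
    rw [ae_all_iff]
    intro q
    have hq : MeasurableSet {ω | g ω ≤ q} := measurableSet_le hg measurable_const
    rcases hf.ae_mem_or_ae_notMem_of_ae_imp hq
      (by filter_upwards [h] with ω hω h' using hω.trans h') with h2 | h2
    · filter_upwards [h2, hf.quasiErgodic.1.ae h2] with ω h3 h4 using ⟨fun _ => h4, fun _ => h3⟩
    · filter_upwards [h2, hf.quasiErgodic.1.ae h2] with ω h3 h4
      exact ⟨fun h => absurd h h3, fun h => absurd h h4⟩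
  have h2 : g ∘ f =ᵐ[μ] g := by
    filter_upwards [h, h1] with ω h3 h4
    refine le_antisymm h3 (not_lt.1 fun h5 => ?_)
    obtain ⟨q, hq1, hq2⟩ := exists_rat_btwn h5
    exact absurd ((h4 q).2 hq1.le) (not_le.2 hq2)
  exact hf.ae_eq_const_of_ae_eq_comp₀ hg.nullMeasurable h2

end Ergodicity

/-! ### Positive fixed points of an irreducible process -/

theorem IsErgodicQuantumProcess.ae_comp {Ω : Type u} [MeasurableSpace Ω] {μ : Measure Ω} {d : ℕ}
    {θ : Ω ≃ᵐ Ω} {φ : Ω → Mat d →ₗ[ℂ] Mat d}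
    (hΦ : IsErgodicQuantumProcess μ θ φ) {P : Ω → Prop}
    (h : ∀ᵐ ω ∂μ, P ω) : ∀ᵐ ω ∂μ, P (θ ω) :=
  hΦ.ergodic.quasiErgodic.1.ae h

section Irreducible

variable {Ω : Type u} [MeasurableSpace Ω] {μ : Measure Ω} {d : ℕ}
  {θ : Ω ≃ᵐ Ω} {φ : Ω → Mat d →ₗ[ℂ] Mat d}

theorem IsIrreducibleProcess.ae_posDef (hΦ : IsErgodicQuantumProcess μ θ φ)
    (hirr : IsIrreducibleProcess μ θ φ) {z : Ω → Mat d} (hz : MeasurableMat z)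
    (hpos : ∀ᵐ ω ∂μ, (z ω).PosSemidef) (hfix : ∀ᵐ ω ∂μ, φ (θ ω) (z ω) = z (θ ω))
    (hne : ¬ ∀ᵐ ω ∂μ, z ω = 0) : ∀ᵐ ω ∂μ, (z ω).PosDef := by
  classical
  have hS := hz.measurableSet_of_isClosed (isClosed_posSemidef d)
  -- Positivity must hold everywhere, not just almost everywhere, for the support projection to be
  -- chosen at every point.
  set w : Ω → Mat d := fun ω => if (z ω).PosSemidef then z ω else 0 with hw
  have hwz : ∀ᵐ ω ∂μ, w ω = z ω := by
    filter_upwards [hpos] with ω h using if_pos h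
  have hwpos : ∀ ω, (w ω).PosSemidef := by
    intro ω
    by_cases h : (z ω).PosSemidef
    · simp only [hw, if_pos h]; exact h
    · simp [hw, h, Matrix.PosSemidef.zero]
  have hwm : MeasurableMat w := by
    intro i j
    have : (fun ω => w ω i j) = fun ω => if (z ω).PosSemidef then z ω i j else 0 := by
      ext ω; by_cases h : (z ω).PosSemidef <;> simp [hw, h]
    rw [this]
    exact Measurable.ite hS (hz i j) measurable_const
  choose p g hlim hp hpw hpg using fun ω => (hwpos ω).exists_support
  have hpm : MeasurableMat p := by
    intro i j
    refine measurable_of_tendsto_metrizable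
      (f := fun (n : ℕ) ω => (w ω * (w ω + ((n : ℂ) + 1)⁻¹ • (1 : Mat d))⁻¹) i j)
      (fun n => (hwm.mul (hwm.add (MeasurableMat.const _)).inv) i j) ?_
    rw [tendsto_pi_nhds]
    intro ω
    exact (((continuous_apply j).comp (continuous_apply i)).tendsto (p ω)).comp (hlim ω)
  have hproj : IsRandomProjection μ p := by
    refine ⟨hpm, ae_of_all _ hp, fun h => hne ?_⟩
    filter_upwards [h, hwz] with ω h1 h2
    rw [← h2, ← hpw ω, h1, Matrix.zero_mul]
  have hred : Reduces μ θ φ p := by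
    filter_upwards [hwz, hΦ.ae_comp hwz, hfix] with ω h1 h2 h3
    refine (hΦ.channel (θ ω)).completelyPositive.image_corner_subset (hwpos ω) (hp ω) (hpg ω)
      (hp (θ ω)) ?_
    rw [h1, h3, ← h2, hpw]
  filter_upwards [hirr p hproj hred, hwz] with ω h1 h2
  rw [← h2, (hwpos ω).posDef_iff_isUnit]
  exact IsUnit.of_mul_eq_one _ ((hpg ω).symm.trans h1)

variable [IsProbabilityMeasure μ]

/-- Subtract from `ρ` the largest multiple `t y` that keeps it positive. The remainder is a positive
fixed point; if nonzero it would be faithful, leaving room to subtract more. -/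
theorem IsIrreducibleProcess.exists_eq_smul (hΦ : IsErgodicQuantumProcess μ θ φ)
    (hirr : IsIrreducibleProcess μ θ φ) {ρ : Ω → Mat d} (hρ : MeasurableMat ρ)
    (hρpos : ∀ᵐ ω ∂μ, (ρ ω).PosSemidef) (hρtr : ∀ᵐ ω ∂μ, (ρ ω).trace = 1)
    (hρfix : ∀ᵐ ω ∂μ, φ (θ ω) (ρ ω) = ρ (θ ω)) {y : Ω → Mat d} (hy : MeasurableMat y)
    (hypos : ∀ᵐ ω ∂μ, (y ω).PosSemidef) (hyfix : ∀ᵐ ω ∂μ, φ (θ ω) (y ω) = y (θ ω)) :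
    ∃ c : ℝ, ∀ᵐ ω ∂μ, y ω = c • ρ ω := by
  obtain ⟨c, hc⟩ := hΦ.ergodic.ae_eq_const_of_comp_ae_le (g := fun ω => (y ω).trace.re)
    (Complex.measurable_re.comp hy.trace) (by
      filter_upwards [hyfix] with ω h
      rw [← h, (hΦ.channel (θ ω)).trace_preserving])
  have htr : ∀ᵐ ω ∂μ, (y ω).trace = c := by
    filter_upwards [hypos, hc] with ω h1 h2
    rw [← h2]
    exact Complex.eq_re_of_ofReal_le (r := 0) (by simpa using h1.trace_nonneg)
  have hc0 : 0 ≤ c := by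
    obtain ⟨ω, h1, h2⟩ := (hypos.and htr).exists
    have := h1.trace_nonneg
    rw [h2] at this
    exact_mod_cast this
  rcases hc0.eq_or_lt with hc0 | hc0
  · refine ⟨0, ?_⟩
    filter_upwards [hypos, htr] with ω h1 h2
    rw [zero_smul, ← h1.trace_eq_zero_iff, h2, ← hc0, Complex.ofReal_zero]
  set Q : Set ℝ := {q | ∀ᵐ ω ∂μ, (ρ ω - q • y ω).PosSemidef} with hQ
  have hQne : Q.Nonempty := ⟨0, by filter_upwards [hρpos] with ω h using by simpa using h⟩
  -- Taking traces gives `1 - q c ≥ 0`, where `c > 0` is the constant trace of `y`.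
  have hQbdd : BddAbove Q := by
    refine ⟨c⁻¹, fun q hq => ?_⟩
    obtain ⟨ω, h1, h2, h3⟩ := ((show ∀ᵐ ω ∂μ, _ from hq).and (htr.and hρtr)).exists
    have h4 := h1.trace_nonneg
    rw [Matrix.trace_sub, Matrix.trace_smul, h2, h3, Complex.real_smul] at h4
    have h5 : 0 ≤ 1 - q * c := by exact_mod_cast h4
    rw [← one_div, le_div_iff₀ hc0]
    linarith
  set t := sSup Q with ht
  have htQ : t ∈ Q := by
    obtain ⟨v, -, hv, hvQ⟩ := exists_seq_tendsto_sSup hQne hQbdd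
    have h1 : ∀ᵐ ω ∂μ, ∀ n, (ρ ω - v n • y ω).PosSemidef := ae_all_iff.2 hvQ
    filter_upwards [h1] with ω h2
    exact (isClosed_posSemidef d).mem_of_tendsto
      (tendsto_const_nhds.sub (hv.smul_const (y ω))) (Eventually.of_forall h2)
  set z : Ω → Mat d := fun ω => ρ ω - t • y ω with hzdef
  have hzm : ∀ q : ℝ, MeasurableMat fun ω => ρ ω - q • y ω := fun q =>
    hρ.sub (MeasurableMat.smul (measurable_const (a := (q : ℂ))) hy)
  have hzfix : ∀ q : ℝ, ∀ᵐ ω ∂μ, φ (θ ω) (ρ ω - q • y ω) = ρ (θ ω) - q • y (θ ω) := by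
    intro q
    filter_upwards [hρfix, hyfix] with ω h1 h2
    rw [map_sub, LinearMap.map_smul_of_tower, h1, h2]
  have hz0 : ∀ᵐ ω ∂μ, z ω = 0 := by
    by_contra hne
    have hzpd := hirr.ae_posDef hΦ (hzm t) htQ (hzfix t) hne
    -- Beyond `t`, the set where the difference is positive is forward invariant; it cannot be
    -- conull by maximality of `t`, so it is null. But faithfulness of `z` puts almost every point
    -- in one of these countably many sets.
    have hnull : ∀ n : ℕ, ∀ᵐ ω ∂μ, ¬ (ρ ω - (t + ((n : ℝ) + 1)⁻¹) • y ω).PosSemidef := by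
      intro n
      refine (hΦ.ergodic.ae_mem_or_ae_notMem_of_ae_imp
        ((hzm (t + ((n : ℝ) + 1)⁻¹)).measurableSet_of_isClosed (isClosed_posSemidef d))
        ?_).resolve_left fun h => ?_
      · filter_upwards [hzfix (t + ((n : ℝ) + 1)⁻¹)] with ω h1 h2
        have h3 := (hΦ.channel (θ ω)).completelyPositive.posSemidef h2
        rwa [h1] at h3
      · have h1 : t + ((n : ℝ) + 1)⁻¹ ≤ t := le_csSup hQbdd h
        have h2 : (0 : ℝ) < ((n : ℝ) + 1)⁻¹ := by positivity
        linarith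
    obtain ⟨ω, h1, h2, h3⟩ := (hzpd.and ((ae_all_iff.2 hnull).and hypos)).exists
    obtain ⟨n, hn⟩ := h1.exists_sub_smul_posSemidef h3
    refine h2 n ?_
    convert hn using 1
    rw [add_smul, sub_add_eq_sub_sub]
  have ht0 : t ≠ 0 := by
    rintro h0
    obtain ⟨ω, h1, h2⟩ := (hz0.and hρtr).exists
    simp only [hzdef, h0, zero_smul, sub_zero] at h1
    simp [h1] at h2
  refine ⟨t⁻¹, ?_⟩
  filter_upwards [hz0] with ω h
  rw [sub_eq_zero.1 h, smul_smul, inv_mul_cancel₀ ht0, one_smul]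

end Irreducible

/-! ### Eigenmatrices of an irreducible process -/

/-- A faithful stationary state of the process. -/
structure IsStationaryState {Ω : Type u} [MeasurableSpace Ω] {d : ℕ} (μ : Measure Ω)
    (θ : Ω ≃ᵐ Ω) (φ : Ω → Mat d →ₗ[ℂ] Mat d) (ρ : Ω → Mat d) : Prop where
  measurable : MeasurableMat ρ
  posDef : ∀ᵐ ω ∂μ, (ρ ω).PosDef
  trace_eq_one : ∀ᵐ ω ∂μ, (ρ ω).trace = 1
  fixed : ∀ᵐ ω ∂μ, φ (θ ω) (ρ ω) = ρ (θ ω)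

/-- A measurable family of matrices, not almost surely zero, that the process multiplies
by `α`. -/
structure IsEigenmatrix {Ω : Type u} [MeasurableSpace Ω] {d : ℕ} (μ : Measure Ω)
    (θ : Ω ≃ᵐ Ω) (φ : Ω → Mat d →ₗ[ℂ] Mat d) (α : ℂ) (x : Ω → Mat d) : Prop where
  measurable : MeasurableMat x
  ne_zero : ¬ ∀ᵐ ω ∂μ, x ω = 0
  map_eq : ∀ᵐ ω ∂μ, φ (θ ω) (x ω) = α • x (θ ω)

section Eigenmatrices

variable {Ω : Type u} [MeasurableSpace Ω] {μ : Measure Ω} {d : ℕ}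
  {θ : Ω ≃ᵐ Ω} {φ : Ω → Mat d →ₗ[ℂ] Mat d} {ρ x z : Ω → Mat d} {α β : ℂ}

theorem IsEigenmatrix.conjTranspose (hΦ : IsErgodicQuantumProcess μ θ φ)
    (hx : IsEigenmatrix μ θ φ α x) : IsEigenmatrix μ θ φ (star α) fun ω => (x ω)ᴴ := by
  refine ⟨hx.measurable.conjTranspose, fun h => hx.ne_zero ?_, ?_⟩
  · filter_upwards [h] with ω h using Matrix.conjTranspose_eq_zero.1 h
  · filter_upwards [hx.map_eq] with ω h
    rw [(hΦ.channel (θ ω)).completelyPositive.map_conjTranspose, h, Matrix.conjTranspose_smul]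

theorem inv_mem_koopmanEigenvalues (hβ : β ∈ koopmanEigenvalues μ θ) :
    β⁻¹ ∈ koopmanEigenvalues μ θ := by
  obtain ⟨f, hf, hf0, hfβ⟩ := hβ
  refine ⟨fun ω => (f ω)⁻¹, hf.inv, fun h => hf0 ?_, ?_⟩
  · filter_upwards [h] with ω h using inv_eq_zero.1 h
  · filter_upwards [hfβ] with ω h1
    rw [h1, mul_inv]

theorem inv_mem_peripheralEigenvalues (hΦ : IsErgodicQuantumProcess μ θ φ)
    (hα : α ∈ peripheralEigenvalues μ θ φ) : α⁻¹ ∈ peripheralEigenvalues μ θ φ := by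
  obtain ⟨hα1, x, hxm, hx0, hxα⟩ := hα
  have h := IsEigenmatrix.conjTranspose hΦ ⟨hxm, hx0, hxα⟩
  rw [Complex.inv_eq_conj hα1]
  exact ⟨by rw [Complex.norm_conj, hα1], _, h.measurable, h.ne_zero, h.map_eq⟩

variable [IsProbabilityMeasure μ]

/-- The Schwarz defect is positive semidefinite, and its trace is the decrement of `tr (x ρ⁻¹ xᴴ)`
from `θ ω` to `ω`. That trace is monotone along orbits, so constant, and the defect has trace zero.
-/
theorem IsEigenmatrix.schwarz_eq (hΦ : IsErgodicQuantumProcess μ θ φ)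
    (hρ : IsStationaryState μ θ φ ρ) (hα : ‖α‖ = 1) (hx : IsEigenmatrix μ θ φ α x) :
    ∀ᵐ ω ∂μ, φ (θ ω) (x ω * (ρ ω)⁻¹ * (x ω)ᴴ) =
      x (θ ω) * (ρ (θ ω))⁻¹ * (x (θ ω))ᴴ := by
  have hαα : star α * α = 1 := by
    rw [Complex.star_def, Complex.conj_mul', hα]; norm_num
  have hpsd : ∀ᵐ ω ∂μ, (φ (θ ω) (x ω * (ρ ω)⁻¹ * (x ω)ᴴ) -
      x (θ ω) * (ρ (θ ω))⁻¹ * (x (θ ω))ᴴ).PosSemidef := by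
    filter_upwards [hρ.posDef, hΦ.ae_comp hρ.posDef, hρ.fixed, hx.map_eq] with ω h1 h2 h3 h4
    have h := (hΦ.channel (θ ω)).completelyPositive.schwarz h1 (by rwa [h3]) (x ω)
    rw [h3, h4, Matrix.conjTranspose_smul, Matrix.smul_mul, Matrix.smul_mul, Matrix.mul_smul,
      smul_smul, mul_comm α, hαα, one_smul] at h
    exact h
  obtain ⟨c, hc⟩ := hΦ.ergodic.ae_eq_const_of_comp_ae_le
    (g := fun ω => (x ω * (ρ ω)⁻¹ * (x ω)ᴴ).trace.re)
    (Complex.measurable_re.comp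
      ((hx.measurable.mul hρ.measurable.inv).mul hx.measurable.conjTranspose).trace) (by
      filter_upwards [hpsd] with ω h
      have h1 := (Complex.le_def.1 h.trace_nonneg).1
      rw [Matrix.trace_sub, (hΦ.channel (θ ω)).trace_preserving, Complex.sub_re,
        Complex.zero_re] at h1
      linarith)
  filter_upwards [hpsd, hc, hΦ.ae_comp hc] with ω h h1 h2
  rw [← sub_eq_zero, ← h.trace_eq_zero_iff]
  have h3 := Complex.le_def.1 h.trace_nonneg
  refine Complex.ext ?_ h3.2.symm
  rw [Matrix.trace_sub, (hΦ.channel (θ ω)).trace_preserving, Complex.sub_re, h1, h2, sub_self,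
    Complex.zero_re]

theorem IsEigenmatrix.exists_mul_eq_smul (hΦ : IsErgodicQuantumProcess μ θ φ)
    (hirr : IsIrreducibleProcess μ θ φ)
    (hρ : IsStationaryState μ θ φ ρ) (hα : ‖α‖ = 1) (hx : IsEigenmatrix μ θ φ α x) :
    ∃ c : ℝ, c ≠ 0 ∧ ∀ᵐ ω ∂μ, x ω * (ρ ω)⁻¹ * (x ω)ᴴ = c • ρ ω := by
  obtain ⟨c, hc⟩ := hirr.exists_eq_smul hΦ hρ.measurable (hρ.posDef.mono fun _ h => h.posSemidef)
    hρ.trace_eq_one hρ.fixed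
    ((hx.measurable.mul hρ.measurable.inv).mul hx.measurable.conjTranspose)
    (hρ.posDef.mono fun ω h => h.inv.posSemidef.mul_mul_conjTranspose_same (x ω))
    (hx.schwarz_eq hΦ hρ hα)
  refine ⟨c, fun h0 => hx.ne_zero ?_, hc⟩
  filter_upwards [hc, hρ.posDef] with ω h1 h2
  rw [h0, zero_smul] at h1
  by_contra hne
  -- If `c = 0` and `x ω ≠ 0`, such a `v` makes the form of `x ρ⁻¹ xᴴ` strictly positive, a
  -- contradiction.
  have h3 : ∃ v : Fin d → ℂ, (x ω)ᴴ *ᵥ v ≠ 0 := by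
    by_contra! hv
    refine hne (Matrix.conjTranspose_eq_zero.1 ?_)
    ext i j
    simpa using congrFun (hv (Pi.single j 1)) i
  obtain ⟨v, hv⟩ := h3
  have h4 := h2.inv.dotProduct_mulVec_pos hv
  have h5 : star ((x ω)ᴴ *ᵥ v) ⬝ᵥ ((ρ ω)⁻¹ *ᵥ ((x ω)ᴴ *ᵥ v)) =
      star v ⬝ᵥ ((x ω * (ρ ω)⁻¹ * (x ω)ᴴ) *ᵥ v) := by
    rw [Matrix.star_mulVec, Matrix.conjTranspose_conjTranspose, ← Matrix.dotProduct_mulVec,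
      Matrix.mulVec_mulVec, Matrix.mulVec_mulVec, Matrix.mul_assoc]
  rw [h5, h1] at h4
  simp at h4

theorem IsEigenmatrix.ae_isUnit (hΦ : IsErgodicQuantumProcess μ θ φ)
    (hirr : IsIrreducibleProcess μ θ φ)
    (hρ : IsStationaryState μ θ φ ρ) (hα : ‖α‖ = 1) (hx : IsEigenmatrix μ θ φ α x) :
    ∀ᵐ ω ∂μ, IsUnit (x ω) := by
  obtain ⟨c, hc0, hc⟩ := hx.exists_mul_eq_smul hΦ hirr hρ hα
  filter_upwards [hc, hρ.posDef] with ω h1 h2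
  have hu := (Matrix.isUnit_iff_isUnit_det _).1 h2.isUnit
  refine IsUnit.of_mul_eq_one (c⁻¹ • ((ρ ω)⁻¹ * (x ω)ᴴ * (ρ ω)⁻¹)) ?_
  rw [Matrix.mul_smul, ← Matrix.mul_assoc, ← Matrix.mul_assoc, h1, Matrix.smul_mul,
    Matrix.mul_nonsing_inv _ hu, smul_smul, inv_mul_cancel₀ hc0, one_smul]

theorem IsEigenmatrix.mul (hd : 1 ≤ d) (hΦ : IsErgodicQuantumProcess μ θ φ)
    (hirr : IsIrreducibleProcess μ θ φ) (hρ : IsStationaryState μ θ φ ρ)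
    (hα : ‖α‖ = 1) (hx : IsEigenmatrix μ θ φ α x)
    (hβ : ‖β‖ = 1) (hz : IsEigenmatrix μ θ φ β z) :
    IsEigenmatrix μ θ φ (α * β) fun ω => x ω * (ρ ω)⁻¹ * z ω := by
  have : NeZero d := ⟨by omega⟩
  refine ⟨(hx.measurable.mul hρ.measurable.inv).mul hz.measurable, fun h => ?_, ?_⟩
  · obtain ⟨ω, h1, h2, h3, h4⟩ := (h.and ((hx.ae_isUnit hΦ hirr hρ hα).and
      ((hz.ae_isUnit hΦ hirr hρ hβ).and hρ.posDef))).exists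
    have h5 := (h2.mul h4.inv.isUnit).mul h3
    rw [h1] at h5
    exact not_isUnit_zero h5
  · have hβ' : ‖star β‖ = 1 := by rwa [norm_star]
    filter_upwards [hρ.posDef, hΦ.ae_comp hρ.posDef, hρ.fixed, hx.map_eq, hz.map_eq,
      hx.schwarz_eq hΦ hρ hα, (hz.conjTranspose hΦ).schwarz_eq hΦ hρ hβ'] with ω h1 h2 h3 h4 h5 h6 h7
    have hcp := (hΦ.channel (θ ω)).completelyPositive
    -- The phases of `γ` cancel, turning the equality for eigenmatrices into equality in the Schwarz
    -- inequality. It is then polarized between `x` and `zᴴ`, which yields the product with `z`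
    -- itself.
    have aux : ∀ {γ : ℂ} {w w' : Mat d}, ‖γ‖ = 1 → φ (θ ω) w = γ • w' →
        φ (θ ω) (w * (ρ ω)⁻¹ * wᴴ) = w' * (ρ (θ ω))⁻¹ * w'ᴴ →
        φ (θ ω) (w * (ρ ω)⁻¹ * wᴴ) = φ (θ ω) w * (φ (θ ω) (ρ ω))⁻¹ * (φ (θ ω) w)ᴴ := by
      intro γ w w' hγ hw hww
      have hγγ : star γ * γ = 1 := by
        rw [Complex.star_def, Complex.conj_mul', hγ]; norm_num
      rw [hww, h3, hw, Matrix.conjTranspose_smul, Matrix.smul_mul, Matrix.smul_mul,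
        Matrix.mul_smul, smul_smul, mul_comm γ, hγγ, one_smul]
    have hzmap : φ (θ ω) (z ω)ᴴ = star β • (z (θ ω))ᴴ := by
      rw [hcp.map_conjTranspose, h5, Matrix.conjTranspose_smul]
    have h := hcp.schwarz_eq h1 (by rwa [h3]) (aux hα h4 h6) (aux hβ' hzmap h7)
    rw [Matrix.conjTranspose_conjTranspose, h3, h4, hzmap, Matrix.conjTranspose_smul,
      Matrix.conjTranspose_conjTranspose, star_star] at h
    rw [h, Matrix.smul_mul, Matrix.smul_mul, Matrix.mul_smul, smul_smul]

theorem IsStationaryState.isEigenmatrix (hρ : IsStationaryState μ θ φ ρ) :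
    IsEigenmatrix μ θ φ 1 ρ := by
  refine ⟨hρ.measurable, fun h => ?_, ?_⟩
  · obtain ⟨ω, h1, h2⟩ := (h.and hρ.trace_eq_one).exists
    simp [h1] at h2
  · filter_upwards [hρ.fixed] with ω h using by rw [h, one_smul]

/-! ### The groups of eigenvalues -/

/-- Whether `‖β‖ ≤ 1` or `‖β‖ ≥ 1`, the modulus of an eigenfunction is monotone along orbits, hence
a nonzero constant. -/
theorem norm_eq_one_of_mem_koopmanEigenvalues (hθ : Ergodic θ μ)
    (hβ : β ∈ koopmanEigenvalues μ θ) : ‖β‖ = 1 := by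
  obtain ⟨f, hf, hne, hfβ⟩ := hβ
  have hconst : ∃ c, ∀ᵐ ω ∂μ, ‖f ω‖ = c := by
    rcases le_total ‖β‖ 1 with h | h
    · refine hθ.ae_eq_const_of_comp_ae_le hf.norm ?_
      filter_upwards [hfβ] with ω h1
      rw [h1, norm_mul]
      exact mul_le_of_le_one_left (norm_nonneg _) h
    · obtain ⟨c, hc⟩ := hθ.ae_eq_const_of_comp_ae_le (g := fun ω => -‖f ω‖) hf.norm.neg (by
        filter_upwards [hfβ] with ω h1
        rw [h1, norm_mul, neg_le_neg_iff]
        exact le_mul_of_one_le_left (norm_nonneg _) h)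
      exact ⟨-c, by filter_upwards [hc] with ω h1 using by rw [← h1, neg_neg]⟩
  obtain ⟨c, hc⟩ := hconst
  have hc0 : c ≠ 0 := by
    rintro rfl
    exact hne (by filter_upwards [hc] with ω h using norm_eq_zero.1 h)
  obtain ⟨ω, h1, h2, h3⟩ := (hc.and ((hθ.quasiErgodic.1.ae hc).and hfβ)).exists
  rw [h3, norm_mul, h1] at h2
  exact (mul_eq_right₀ hc0).1 h2

theorem one_mem_koopmanEigenvalues : (1 : ℂ) ∈ koopmanEigenvalues μ θ :=
  ⟨fun _ => 1, measurable_const, fun h => by simpa using h.exists,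
    ae_of_all _ fun _ => by simp⟩

theorem ae_ne_zero_of_koopman (hθ : Ergodic θ μ) {f : Ω → ℂ} (hf : Measurable f)
    (hne : ¬ ∀ᵐ ω ∂μ, f ω = 0) (hfβ : ∀ᵐ ω ∂μ, f (θ ω) = β * f ω) : ∀ᵐ ω ∂μ, f ω ≠ 0 := by
  refine (hθ.ae_mem_or_ae_notMem_of_ae_imp (s := {ω | f ω = 0})
    (hf (measurableSet_singleton 0)) ?_).resolve_left hne
  filter_upwards [hfβ] with ω h1 h2
  show f (θ ω) = 0
  rw [h1, show f ω = 0 from h2, mul_zero]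

theorem mul_mem_koopmanEigenvalues (hθ : Ergodic θ μ) (hα : α ∈ koopmanEigenvalues μ θ)
    (hβ : β ∈ koopmanEigenvalues μ θ) : α * β ∈ koopmanEigenvalues μ θ := by
  obtain ⟨f, hf, hf0, hfα⟩ := hα
  obtain ⟨g, hg, hg0, hgβ⟩ := hβ
  refine ⟨fun ω => f ω * g ω, hf.mul hg, fun h => ?_, ?_⟩
  · obtain ⟨ω, h1, h2, h3⟩ := (h.and ((ae_ne_zero_of_koopman hθ hf hf0 hfα).and
      (ae_ne_zero_of_koopman hθ hg hg0 hgβ))).exists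
    exact mul_ne_zero h2 h3 h1
  · filter_upwards [hfα, hgβ] with ω h1 h2
    rw [h1, h2]; ring

/-- The eigenmatrix is `f • ρ`. The inverse appears because `φ` carries the value at `ω` to `θ ω`,
while `f ∘ θ = β f` reads in the other direction. -/
theorem inv_mem_peripheralEigenvalues_of_koopman (hΦ : IsErgodicQuantumProcess μ θ φ)
    (hρ : IsStationaryState μ θ φ ρ) (hβ : β ∈ koopmanEigenvalues μ θ) :
    β⁻¹ ∈ peripheralEigenvalues μ θ φ := by
  have hβ1 := norm_eq_one_of_mem_koopmanEigenvalues hΦ.ergodic hβ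
  have hβ0 : β ≠ 0 := by rintro rfl; simp at hβ1
  obtain ⟨f, hf, hf0, hfβ⟩ := hβ
  refine ⟨by rw [norm_inv, hβ1, inv_one], fun ω => f ω • ρ ω,
    MeasurableMat.smul hf hρ.measurable, fun h => hf0 ?_, ?_⟩
  · filter_upwards [h, hρ.trace_eq_one] with ω h1 h2
    have h3 := congrArg Matrix.trace h1
    rwa [Matrix.trace_smul, h2, Matrix.trace_zero, smul_eq_mul, mul_one] at h3
  · filter_upwards [hfβ, hρ.fixed] with ω h1 h2
    rw [map_smul, h1, h2, smul_smul, inv_mul_cancel_left₀ hβ0]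

/-- Multiply the Cayley–Hamilton identity by `R` and take traces: if all the traces vanished, only
`± det A * tr R` would survive, and it is nonzero. -/
theorem Matrix.exists_trace_pow_mul_ne_zero {d : ℕ} (hd : 1 ≤ d) {A R : Mat d} (hA : IsUnit A)
    (hR : R.trace ≠ 0) : ∃ k, 1 ≤ k ∧ k ≤ d ∧ (A ^ k * R).trace ≠ 0 := by
  have : NeZero d := ⟨by omega⟩
  by_contra! h
  have h1 := congrArg (fun M => (M * R).trace) A.aeval_self_charpoly
  simp only [Polynomial.aeval_eq_sum_range, Matrix.charpoly_natDegree_eq_dim, Fintype.card_fin,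
    Finset.sum_mul, Matrix.trace_sum, Matrix.zero_mul, Matrix.trace_zero] at h1
  rw [Finset.sum_range_succ', Finset.sum_eq_zero] at h1
  · have h2 : A.charpoly.coeff 0 ≠ 0 := by
      intro h3
      have h4 := A.det_eq_sign_charpoly_coeff
      rw [h3, mul_zero] at h4
      have h5 := (Matrix.isUnit_iff_isUnit_det A).1 hA
      rw [h4] at h5
      exact not_isUnit_zero h5
    rw [pow_zero, Matrix.smul_mul, Matrix.trace_smul, Matrix.one_mul, zero_add] at h1
    exact (smul_ne_zero h2 hR) h1
  · intro k hk
    rw [Matrix.smul_mul, Matrix.trace_smul, h (k + 1) (by omega)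
      (by have := Finset.mem_range.1 hk; omega), smul_zero]

theorem exists_pow_mem_koopmanEigenvalues (hd : 1 ≤ d) (hΦ : IsErgodicQuantumProcess μ θ φ)
    (hirr : IsIrreducibleProcess μ θ φ) (hρ : IsStationaryState μ θ φ ρ)
    (hα : α ∈ peripheralEigenvalues μ θ φ) :
    ∃ k, 1 ≤ k ∧ k ≤ d ∧ α ^ k ∈ koopmanEigenvalues μ θ := by
  obtain ⟨hα1, x, hxm, hx0, hxα⟩ := hα
  have hx : IsEigenmatrix μ θ φ α x := ⟨hxm, hx0, hxα⟩
  have hpow : ∀ k : ℕ, IsEigenmatrix μ θ φ (α ^ k) fun ω => (x ω * (ρ ω)⁻¹) ^ k * ρ ω := by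
    intro k
    induction k with
    | zero => simpa using hρ.isEigenmatrix
    | succ k ih =>
      have h := hx.mul hd hΦ hirr hρ hα1 (by rw [norm_pow, hα1, one_pow]) ih
      simpa only [pow_succ', Matrix.mul_assoc] using h
  by_contra! hk
  have hzero : ∀ k, 1 ≤ k → k ≤ d → ∀ᵐ ω ∂μ, ((x ω * (ρ ω)⁻¹) ^ k * ρ ω).trace = 0 := by
    intro k hk1 hkd
    by_contra hne
    refine hk k hk1 hkd ?_
    rw [← inv_inv (α ^ k)]
    refine inv_mem_koopmanEigenvalues ⟨_, (hpow k).measurable.trace, hne, ?_⟩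
    have hαk : α ^ k ≠ 0 := by
      refine pow_ne_zero _ ?_
      rintro rfl; simp at hα1
    filter_upwards [(hpow k).map_eq] with ω h
    have h1 := congrArg Matrix.trace h
    rw [(hΦ.channel (θ ω)).trace_preserving, Matrix.trace_smul, smul_eq_mul] at h1
    rw [h1, inv_mul_cancel_left₀ hαk]
  have hall : ∀ᵐ ω ∂μ, ∀ k, 1 ≤ k → k ≤ d → ((x ω * (ρ ω)⁻¹) ^ k * ρ ω).trace = 0 := by
    rw [ae_all_iff]
    intro k
    by_cases hk1 : 1 ≤ k ∧ k ≤ d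
    · filter_upwards [hzero k hk1.1 hk1.2] with ω h _ _ using h
    · exact ae_of_all _ fun ω h1 h2 => absurd ⟨h1, h2⟩ hk1
  obtain ⟨ω, h1, h2, h3, h4⟩ := (hall.and ((hx.ae_isUnit hΦ hirr hρ hα1).and
    (hρ.posDef.and hρ.trace_eq_one))).exists
  obtain ⟨k, hk1, hkd, hk0⟩ := Matrix.exists_trace_pow_mul_ne_zero hd
    (h2.mul h3.inv.isUnit) (R := ρ ω) (by rw [h4]; exact one_ne_zero)
  exact hk0 (h1 k hk1 hkd)

theorem mul_mem_peripheralEigenvalues (hd : 1 ≤ d) (hΦ : IsErgodicQuantumProcess μ θ φ)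
    (hirr : IsIrreducibleProcess μ θ φ) (hρ : IsStationaryState μ θ φ ρ)
    (hα : α ∈ peripheralEigenvalues μ θ φ) (hβ : β ∈ peripheralEigenvalues μ θ φ) :
    α * β ∈ peripheralEigenvalues μ θ φ := by
  obtain ⟨hα1, x, hxm, hx0, hxα⟩ := hα
  obtain ⟨hβ1, z, hzm, hz0, hzβ⟩ := hβ
  have h := IsEigenmatrix.mul hd hΦ hirr hρ hα1 ⟨hxm, hx0, hxα⟩ hβ1 ⟨hzm, hz0, hzβ⟩
  exact ⟨by rw [norm_mul, hα1, hβ1, one_mul], _, h.measurable, h.ne_zero, h.map_eq⟩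

end Eigenmatrices

/-- A multiplicatively closed set of nonzero complex numbers as a subgroup of the units. -/
theorem exists_isSubgroupOfUnits {Λ : Set ℂ} (h0 : 0 ∉ Λ) (h1 : 1 ∈ Λ)
    (hmul : ∀ a ∈ Λ, ∀ b ∈ Λ, a * b ∈ Λ) (hinv : ∀ a ∈ Λ, a⁻¹ ∈ Λ) :
    ∃ G : Subgroup ℂˣ, IsSubgroupOfUnits G Λ ∧ ∀ u : ℂˣ, u ∈ G ↔ (u : ℂ) ∈ Λ := by
  refine ⟨{ carrier := {u | (u : ℂ) ∈ Λ}, mul_mem' := fun {a b} ha hb => ?_,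
            one_mem' := by simpa using h1, inv_mem' := fun {a} ha => ?_ }, ?_, fun u => Iff.rfl⟩
  · simpa using hmul _ ha _ hb
  · simpa using hinv _ ha
  · ext a
    refine ⟨?_, fun ha => ⟨Units.mk0 a fun h => h0 (h ▸ ha), ha, rfl⟩⟩
    rintro ⟨u, hu, rfl⟩
    exact hu

/-- A commutative group in which any two elements lie in a common cyclic subgroup and whose
elements have order at most `d` is cyclic of order at most `d`. -/
theorem isCyclic_of_forall_exists_zpowers {Q : Type*} [Group Q] {d : ℕ}
    (hcyc : ∀ q r : Q, ∃ s : Q, q ∈ Subgroup.zpowers s ∧ r ∈ Subgroup.zpowers s)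
    (hord : ∀ q : Q, 0 < orderOf q ∧ orderOf q ≤ d) :
    IsCyclic Q ∧ Finite Q ∧ Nat.card Q ≤ d := by
  have hb : BddAbove (Set.range (orderOf : Q → ℕ)) := ⟨d, by rintro _ ⟨q, rfl⟩; exact (hord q).2⟩
  obtain ⟨q, hq⟩ := Nat.sSup_mem (Set.range_nonempty (orderOf : Q → ℕ)) hb
  have hmax : ∀ r : Q, orderOf r ≤ orderOf q := fun r => hq ▸ le_csSup hb ⟨r, rfl⟩
  have hgen : ∀ r : Q, r ∈ Subgroup.zpowers q := by
    intro r
    obtain ⟨s, h1, h2⟩ := hcyc q r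
    have hfin : Finite (Subgroup.zpowers s) :=
      Nat.finite_of_card_ne_zero (by rw [Nat.card_zpowers]; exact (hord s).1.ne')
    -- The powers of `q` lie among those of `s`, and `q` has maximal order, so the two cyclic groups
    -- coincide.
    rwa [Subgroup.eq_of_le_of_card_ge (Subgroup.zpowers_le.2 h1)
      (by simpa only [Nat.card_zpowers] using hmax s)]
  have hcard : orderOf q = Nat.card Q := orderOf_eq_card_of_forall_mem_zpowers hgen
  exact ⟨⟨q, hgen⟩, Nat.finite_of_card_ne_zero (hcard ▸ (hord q).1.ne'), hcard ▸ (hord q).2⟩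

/-- Both elements are `(m n)`-th roots of unity, and subgroups of that cyclic group are cyclic. -/
theorem exists_mem_zpowers_of_torsion {G : Subgroup ℂˣ} {a b : ℂˣ} (ha : a ∈ G) (hb : b ∈ G)
    {m n : ℕ} (hm : 0 < m) (hn : 0 < n) (ham : a ^ m = 1) (hbn : b ^ n = 1) :
    ∃ s ∈ G, a ∈ Subgroup.zpowers s ∧ b ∈ Subgroup.zpowers s := by
  have : NeZero (m * n) := ⟨(Nat.mul_pos hm hn).ne'⟩
  have hle : Subgroup.closure {a, b} ≤ rootsOfUnity (m * n) ℂ := by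
    rw [Subgroup.closure_le]
    rintro u (rfl | rfl)
    · show _ ^ _ = _
      rw [pow_mul, ham, one_pow]
    · show _ ^ _ = _
      rw [mul_comm, pow_mul, hbn, one_pow]
  have hcyc : IsCyclic (Subgroup.closure {a, b}) := Subgroup.isCyclic_of_le hle
  obtain ⟨s, hs⟩ := (Subgroup.isCyclic_iff_exists_zpowers_eq_top _).1 hcyc
  have hG : Subgroup.closure {a, b} ≤ G := by
    rw [Subgroup.closure_le]
    rintro u (rfl | rfl)
    exacts [ha, hb]
  refine ⟨s, hG (hs ▸ Subgroup.mem_zpowers s), ?_, ?_⟩ <;>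
  · rw [hs]
    exact Subgroup.subset_closure (by simp)

theorem isCyclic_quotient_of_torsion {G H : Subgroup ℂˣ} {d : ℕ}
    (hH : ∀ u ∈ H, ∃ n : ℕ, 0 < n ∧ u ^ n = 1)
    (hG : ∀ u ∈ G, ∃ k, 1 ≤ k ∧ k ≤ d ∧ u ^ k ∈ H) :
    IsCyclic (G ⧸ H.subgroupOf G) ∧ Finite (G ⧸ H.subgroupOf G) ∧
      Nat.card (G ⧸ H.subgroupOf G) ≤ d := by
  have htor : ∀ u ∈ G, ∃ n : ℕ, 0 < n ∧ u ^ n = 1 := by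
    intro u hu
    obtain ⟨k, hk, -, hkH⟩ := hG u hu
    obtain ⟨n, hn, h⟩ := hH _ hkH
    exact ⟨k * n, Nat.mul_pos hk hn, by rw [pow_mul, h]⟩
  refine isCyclic_of_forall_exists_zpowers (fun q r => ?_) (fun q => ?_)
  · induction q using QuotientGroup.induction_on with | H a =>
    induction r using QuotientGroup.induction_on with | H b =>
    obtain ⟨m, hm, ham⟩ := htor a a.2
    obtain ⟨n, hn, hbn⟩ := htor b b.2
    obtain ⟨s, hs, ⟨i, hi⟩, ⟨j, hj⟩⟩ := exists_mem_zpowers_of_torsion a.2 b.2 hm hn ham hbn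
    refine ⟨((⟨s, hs⟩ : G) : G ⧸ H.subgroupOf G), ⟨i, ?_⟩, ⟨j, ?_⟩⟩
    · show ((⟨s, hs⟩ : G) : G ⧸ H.subgroupOf G) ^ i = _
      rw [← QuotientGroup.mk_zpow]
      congr 1
      exact Subtype.ext hi
    · show ((⟨s, hs⟩ : G) : G ⧸ H.subgroupOf G) ^ j = _
      rw [← QuotientGroup.mk_zpow]
      congr 1
      exact Subtype.ext hj
  · induction q using QuotientGroup.induction_on with | H a =>
    obtain ⟨k, hk, hkd, hkH⟩ := hG a a.2
    have h1 : ((a : G ⧸ H.subgroupOf G)) ^ k = 1 := by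
      rw [← QuotientGroup.mk_pow, QuotientGroup.eq_one_iff]
      exact Subgroup.mem_subgroupOf.2 hkH
    exact ⟨orderOf_pos_iff.2 (isOfFinOrder_iff_pow_eq_one.2 ⟨k, hk, h1⟩),
      (orderOf_le_of_pow_eq_one hk h1).trans hkd⟩

theorem exists_subgroups_of_isStationaryState {Ω : Type u} [MeasurableSpace Ω] {μ : Measure Ω}
    [IsProbabilityMeasure μ] {d : ℕ} {θ : Ω ≃ᵐ Ω} {φ : Ω → Mat d →ₗ[ℂ] Mat d} {ρ : Ω → Mat d}
    (hd : 1 ≤ d) (hΦ : IsErgodicQuantumProcess μ θ φ) (hirr : IsIrreducibleProcess μ θ φ)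
    (hρ : IsStationaryState μ θ φ ρ) (htor : IsTorsionSet (koopmanEigenvalues μ θ)) :
    ∃ G H : Subgroup ℂˣ,
      IsSubgroupOfUnits G (peripheralEigenvalues μ θ φ) ∧
      IsSubgroupOfUnits H (koopmanEigenvalues μ θ) ∧ H ≤ G ∧
      IsCyclic (G ⧸ H.subgroupOf G) ∧ Finite (G ⧸ H.subgroupOf G) ∧
      Nat.card (G ⧸ H.subgroupOf G) ≤ d := by
  have hKP : ∀ β ∈ koopmanEigenvalues μ θ, β ∈ peripheralEigenvalues μ θ φ := fun β hβ =>
    inv_inv β ▸ inv_mem_peripheralEigenvalues_of_koopman hΦ hρ (inv_mem_koopmanEigenvalues hβ)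
  obtain ⟨G, hG, hGmem⟩ := exists_isSubgroupOfUnits (Λ := peripheralEigenvalues μ θ φ)
    (fun h => by simpa using h.1) (hKP 1 one_mem_koopmanEigenvalues)
    (fun a ha b hb => mul_mem_peripheralEigenvalues hd hΦ hirr hρ ha hb)
    (fun a ha => inv_mem_peripheralEigenvalues hΦ ha)
  obtain ⟨H, hH, hHmem⟩ := exists_isSubgroupOfUnits (Λ := koopmanEigenvalues μ θ)
    (fun h => by simpa using norm_eq_one_of_mem_koopmanEigenvalues hΦ.ergodic h)
    one_mem_koopmanEigenvalues
    (fun a ha b hb => mul_mem_koopmanEigenvalues hΦ.ergodic ha hb)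
    (fun a ha => inv_mem_koopmanEigenvalues ha)
  refine ⟨G, H, hG, hH, fun u hu => (hGmem u).2 (hKP u ((hHmem u).1 hu)),
    isCyclic_quotient_of_torsion (fun u hu => ?_) (fun u hu => ?_)⟩
  · obtain ⟨n, hn, h⟩ := htor u ((hHmem u).1 hu)
    exact ⟨n, hn, Units.ext (by simpa using h)⟩
  · obtain ⟨k, hk, hkd, h⟩ :=
      exists_pow_mem_koopmanEigenvalues hd hΦ hirr hρ ((hGmem u).1 hu)
    exact ⟨k, hk, hkd, (hHmem _).2 (by simpa using h)⟩

/-! ### A fixed point theorem in Hilbert space -/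

/-- This stands in for weak compactness. The points of least norm in the `K n` have increasing
bounded norms, and the obtuse-angle inequality at a nearest point turns this into a Cauchy estimate.
-/
theorem nonempty_iInter_of_antitone_of_convex {H : Type*} [NormedAddCommGroup H]
    [InnerProductSpace ℝ H] [CompleteSpace H] {K : ℕ → Set H} (hanti : Antitone K)
    (hne : ∀ n, (K n).Nonempty) (hcl : ∀ n, IsClosed (K n)) (hconv : ∀ n, Convex ℝ (K n))
    (hb : Bornology.IsBounded (K 0)) : (⋂ n, K n).Nonempty := by
  have hex : ∀ n, ∃ v ∈ K n, ∀ w ∈ K n, ‖v‖ ^ 2 + ‖w - v‖ ^ 2 ≤ ‖w‖ ^ 2 := by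
    intro n
    obtain ⟨v, hv, hmin⟩ := exists_norm_eq_iInf_of_complete_convex (hne n) (hcl n).isComplete
      (hconv n) 0
    refine ⟨v, hv, fun w hw => ?_⟩
    have h1 := (norm_eq_iInf_iff_real_inner_le_zero (hconv n) hv).1 hmin w hw
    rw [zero_sub, inner_neg_left] at h1
    have h2 := norm_add_sq_real v (w - v)
    rw [add_sub_cancel] at h2
    linarith
  choose v hv hmin using hex
  have hstep : ∀ {m n}, m ≤ n → ‖v m‖ ^ 2 + ‖v n - v m‖ ^ 2 ≤ ‖v n‖ ^ 2 :=
    fun {m n} hmn => hmin m (v n) (hanti hmn (hv n))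
  have hmono : Monotone fun n => ‖v n‖ ^ 2 := fun m n hmn =>
    le_trans (le_add_of_nonneg_right (sq_nonneg _)) (hstep hmn)
  obtain ⟨R, hR⟩ := hb.exists_norm_le
  have hbdd : BddAbove (Set.range fun n => ‖v n‖ ^ 2) := by
    refine ⟨R ^ 2, ?_⟩
    rintro _ ⟨n, rfl⟩
    exact pow_le_pow_left₀ (norm_nonneg _) (hR _ (hanti (Nat.zero_le n) (hv n))) 2
  have hlim := tendsto_atTop_ciSup hmono hbdd
  set a := ⨆ n, ‖v n‖ ^ 2 with ha
  have hcauchy : CauchySeq v := by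
    refine cauchySeq_of_le_tendsto_0' (fun n => √(a - ‖v n‖ ^ 2)) (fun m n hmn => ?_) ?_
    · rw [dist_comm, dist_eq_norm]
      apply Real.le_sqrt_of_sq_le
      have := hstep hmn
      have h1 : ‖v n‖ ^ 2 ≤ a := le_ciSup hbdd n
      linarith
    · have h1 := (hlim.const_sub a).sqrt
      rwa [sub_self, Real.sqrt_zero] at h1
  obtain ⟨x, hx⟩ := cauchySeq_tendsto_of_complete hcauchy
  refine ⟨x, Set.mem_iInter.2 fun n => (hcl n).mem_of_tendsto hx ?_⟩
  filter_upwards [eventually_ge_atTop n] with m hm using hanti hm (hv m)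

/-- Birkhoff averages of an orbit stay in `K` and are asymptotically fixed, so the sets of almost
fixed points are nonempty. They are also nested, closed and convex, and a common point is fixed. -/
theorem ContinuousLinearMap.exists_fixedPoint_of_mapsTo {H : Type*} [NormedAddCommGroup H]
    [InnerProductSpace ℝ H] [CompleteSpace H] {K : Set H} (hne : K.Nonempty) (hcl : IsClosed K)
    (hconv : Convex ℝ K) (hb : Bornology.IsBounded K) (T : H →L[ℝ] H) (hT : Set.MapsTo T K K) :
    ∃ x ∈ K, T x = x := by
  set L : ℕ → Set H := fun n => K ∩ {x | ‖T x - x‖ ≤ ((n : ℝ) + 1)⁻¹} with hL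
  have hLne : ∀ n, (L n).Nonempty := by
    intro n
    obtain ⟨x, hx⟩ := hne
    have hit : ∀ k, T^[k] x ∈ K := fun k => hT.iterate k hx
    have hlim := tendsto_birkhoffAverage_apply_sub_birkhoffAverage ℝ (f := T) (g := id) (x := x)
      (hb.subset (by rintro _ ⟨k, rfl⟩; exact hit k))
    have hpos : (0 : ℝ) < ((n : ℝ) + 1)⁻¹ := by positivity
    obtain ⟨N, hN1, hN⟩ := ((eventually_ge_atTop 1).and
      ((Metric.tendsto_nhds.1 hlim) _ hpos)).exists
    rw [dist_zero_right] at hN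
    have hNpos : (0 : ℝ) < N := by exact_mod_cast hN1
    refine ⟨birkhoffAverage ℝ T id N x, ?_, ?_⟩
    · rw [birkhoffAverage, birkhoffSum, Finset.smul_sum]
      refine hconv.sum_mem (fun _ _ => by positivity) ?_ fun k _ => hit k
      rw [Finset.sum_const, Finset.card_range, nsmul_eq_mul, mul_inv_cancel₀ hNpos.ne']
    · have h1 : T (birkhoffAverage ℝ T id N x) = birkhoffAverage ℝ T id N (T x) := by
        rw [map_birkhoffAverage ℝ ℝ]
        simp only [birkhoffAverage, birkhoffSum, Function.comp, id, ← Function.iterate_succ_apply,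
          ← Function.iterate_succ_apply']
      show ‖_‖ ≤ _
      rw [h1]
      exact hN.le
  obtain ⟨x, hx⟩ := nonempty_iInter_of_antitone_of_convex (K := L)
    (fun m n hmn x hx => ⟨hx.1, le_trans (show ‖T x - x‖ ≤ _ from hx.2)
      (by
        have : (m : ℝ) ≤ n := by exact_mod_cast hmn
        gcongr)⟩) hLne
    (fun n => hcl.inter (isClosed_le (by fun_prop) continuous_const))
    (fun n => by
      refine hconv.inter ?_
      have h := (convex_closedBall (0 : H) ((n : ℝ) + 1)⁻¹).linear_preimage
        ((T - ContinuousLinearMap.id ℝ H : H →L[ℝ] H) : H →ₗ[ℝ] H)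
      convert h using 1
      ext x
      simp)
    (hb.subset Set.inter_subset_left)
  rw [Set.mem_iInter] at hx
  refine ⟨x, (hx 0).1, ?_⟩
  rw [← sub_eq_zero, ← norm_le_zero_iff]
  have h0 : Tendsto (fun n : ℕ => ((n : ℝ) + 1)⁻¹) atTop (𝓝 0) := by
    simpa using tendsto_one_div_add_atTop_nhds_zero_nat (𝕜 := ℝ)
  exact ge_of_tendsto' h0 fun n => (hx n).2

/-! ### Random operators on `L²` -/

theorem exists_continuousLinearMap_Lp_ae_eq {Ω : Type u} [MeasurableSpace Ω] {μ : Measure Ω}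
    {E : Type*} [NormedAddCommGroup E] [NormedSpace ℝ E] (L : Ω → E →ₗ[ℝ] E)
    (hL : ∀ x : Ω → E, StronglyMeasurable x → StronglyMeasurable fun ω => L ω (x ω))
    {C : ℝ} (hC : ∀ ω v, ‖L ω v‖ ≤ C * ‖v‖) :
    ∃ A : Lp E 2 μ →L[ℝ] Lp E 2 μ, ∀ x, A x =ᵐ[μ] fun ω => L ω (x ω) := by
  have hmem : ∀ x : Lp E 2 μ, MemLp (fun ω => L ω (x ω)) 2 μ := fun x =>
    (Lp.memLp x).of_le_mul (hL _ (Lp.stronglyMeasurable x)).aestronglyMeasurable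
      (ae_of_all _ fun ω => hC ω _)
  have hcoe : ∀ x, (hmem x).toLp =ᵐ[μ] fun ω => L ω (x ω) := fun x => (hmem x).coeFn_toLp
  refine ⟨LinearMap.mkContinuous
    { toFun := fun x => (hmem x).toLp
      map_add' := fun x y => ?_
      map_smul' := fun c x => ?_ } C fun x => ?_, hcoe⟩
  · apply Lp.ext
    filter_upwards [hcoe (x + y), Lp.coeFn_add (hmem x).toLp (hmem y).toLp, hcoe x, hcoe y,
      Lp.coeFn_add x y] with ω h1 h2 h3 h4 h5
    rw [h1, h2, Pi.add_apply, h3, h4, h5, Pi.add_apply, map_add]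
  · apply Lp.ext
    filter_upwards [hcoe (c • x), Lp.coeFn_smul c (hmem x).toLp, hcoe x,
      Lp.coeFn_smul c x] with ω h1 h2 h3 h4
    rw [h1, RingHom.id_apply, h2, Pi.smul_apply, h3, h4, Pi.smul_apply, map_smul]
  · refine Lp.norm_le_mul_norm_of_ae_le_mul ?_
    filter_upwards [hcoe x] with ω h
    exact (congrArg norm h).le.trans (hC ω _)

theorem isClosed_setOf_ae_mem {Ω : Type u} [MeasurableSpace Ω] {μ : Measure Ω}
    {E : Type*} [NormedAddCommGroup E] {S : Set E} (hS : IsClosed S) :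
    IsClosed {x : Lp E 2 μ | ∀ᵐ ω ∂μ, x ω ∈ S} := by
  refine IsSeqClosed.isClosed fun x y hx hxy => ?_
  obtain ⟨ns, -, hns⟩ := (tendstoInMeasure_of_tendsto_Lp hxy).exists_seq_tendsto_ae
  filter_upwards [hns, ae_all_iff.2 fun n => hx (ns n)] with ω h1 h2
  exact hS.mem_of_tendsto h1 (Eventually.of_forall h2)

/-! ### Existence of a stationary state -/

/-- The minor on the indices `i, j` gives `‖M i j‖² ≤ M i i * M j j`, and each diagonal entry is at
most the trace. -/
theorem Matrix.PosSemidef.norm_apply_le_trace {n : Type*} [Fintype n] {M : Matrix n n ℂ}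
    (hM : M.PosSemidef) (i j : n) : ‖M i j‖ ≤ M.trace.re := by
  have hdiag : ∀ k, 0 ≤ (M k k).re := fun k => (Complex.le_def.1 hM.diag_nonneg).1
  have hdiag' : ∀ k, M k k = ((M k k).re : ℂ) := fun k =>
    Complex.eq_re_of_ofReal_le (r := 0) (by simpa using hM.diag_nonneg (i := k))
  have hle : ∀ k, (M k k).re ≤ M.trace.re := by
    intro k
    rw [Matrix.trace, Complex.re_sum]
    exact Finset.single_le_sum (f := fun k => (M k k).re) (fun k _ => hdiag k) (Finset.mem_univ k)
  have hdet := (hM.submatrix ![i, j]).det_nonneg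
  rw [Matrix.det_fin_two] at hdet
  simp only [Matrix.submatrix_apply, Matrix.cons_val_zero, Matrix.cons_val_one] at hdet
  rw [← hM.1.apply j i, Complex.star_def, Complex.mul_conj, hdiag' i, hdiag' j,
    Complex.normSq_eq_norm_sq] at hdet
  have h1 : 0 ≤ (M i i).re * (M j j).re - ‖M i j‖ ^ 2 := by exact_mod_cast hdet
  have h2 : (M i i).re * (M j j).re ≤ M.trace.re * M.trace.re :=
    mul_le_mul (hle i) (hle j) (hdiag j) ((hdiag i).trans (hle i))
  nlinarith [norm_nonneg (M i j), (hdiag i).trans (hle i)]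

/-- The entry lies in an off-diagonal block of a positive matrix whose diagonal blocks are the
images of a rank-one matrix unit, of trace `1`, and of the identity, of trace `d`. A bound uniform
over channels makes the process act boundedly on `L²`. -/
theorem IsQuantumChannel.norm_apply_single_le {d : ℕ} {ψ : Mat d →ₗ[ℂ] Mat d}
    (hψ : IsQuantumChannel ψ) (k l i j : Fin d) :
    ‖ψ (Matrix.single k l 1) i j‖ ≤ 1 + d := by
  have h := (hψ.completelyPositive.fromBlocks
    (Matrix.PosSemidef.one.gram_fromBlocks (Matrix.single k l 1) 1)).norm_apply_le_trace
      (Sum.inl i) (Sum.inr j)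
  have htr : ∀ A B C D : Mat d, (Matrix.fromBlocks A B C D).trace = A.trace + D.trace :=
    fun A B C D => by simp [Matrix.trace]
  rw [htr, hψ.trace_preserving, hψ.trace_preserving] at h
  simpa using h

/-- Square matrices as vectors of a Euclidean space. -/
def matEuclidean (d : ℕ) : EuclideanSpace ℂ (Fin d × Fin d) ≃ₗ[ℂ] Mat d :=
  (WithLp.linearEquiv 2 ℂ (Fin d × Fin d → ℂ)).trans
    ((LinearEquiv.curry ℂ ℂ (Fin d) (Fin d)).trans (Matrix.ofLinearEquiv ℂ))

theorem matEuclidean_symm_apply {d : ℕ} (a : Mat d) (p : Fin d × Fin d) :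
    (matEuclidean d).symm a p = a p.1 p.2 := rfl

theorem norm_euclidean_le_of_forall {d : ℕ} {v : EuclideanSpace ℂ (Fin d × Fin d)} {B : ℝ}
    (hB : 0 ≤ B) (h : ∀ p, ‖v p‖ ≤ B) : ‖v‖ ≤ d * B := by
  rw [EuclideanSpace.norm_eq]
  refine Real.sqrt_le_iff.2 ⟨by positivity, ?_⟩
  refine (Finset.sum_le_card_nsmul _ _ (B ^ 2) fun p _ =>
    pow_le_pow_left₀ (norm_nonneg _) (h p) 2).trans ?_
  simp only [Finset.card_univ, Fintype.card_prod, Fintype.card_fin, nsmul_eq_mul, Nat.cast_mul]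
  nlinarith

theorem IsQuantumChannel.norm_euclidean_le {d : ℕ} {ψ : Mat d →ₗ[ℂ] Mat d}
    (hψ : IsQuantumChannel ψ) (v : EuclideanSpace ℂ (Fin d × Fin d)) :
    ‖(matEuclidean d).symm (ψ (matEuclidean d v))‖ ≤ d * (d * d * (1 + d)) * ‖v‖ := by
  rw [mul_assoc]
  refine norm_euclidean_le_of_forall (by positivity) fun p => ?_
  rw [matEuclidean_symm_apply]
  have h : ψ (matEuclidean d v) p.1 p.2 =
      ∑ k, ∑ l, v (k, l) * ψ (Matrix.single k l 1) p.1 p.2 := by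
    conv_lhs => rw [Matrix.matrix_eq_sum_single (matEuclidean d v)]
    simp only [map_sum, Matrix.sum_apply]
    refine Finset.sum_congr rfl fun k _ => Finset.sum_congr rfl fun l _ => ?_
    rw [← mul_one (matEuclidean d v k l), ← smul_eq_mul, ← Matrix.smul_single, map_smul,
      Matrix.smul_apply]
    rfl
  rw [h]
  have hterm : ∀ k l, ‖v (k, l) * ψ (Matrix.single k l 1) p.1 p.2‖ ≤ (1 + d) * ‖v‖ := by
    intro k l
    rw [norm_mul, mul_comm]
    exact mul_le_mul (hψ.norm_apply_single_le k l _ _) (PiLp.norm_apply_le v (k, l))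
      (norm_nonneg _) (by positivity)
  refine (norm_sum_le_of_le _ fun k _ => norm_sum_le_of_le _ fun l _ => hterm k l).trans ?_
  simp only [Finset.sum_const, Finset.card_univ, Fintype.card_fin, nsmul_eq_mul]
  exact le_of_eq (by ring)

theorem exists_invariant_state {Ω : Type u} [MeasurableSpace Ω] {μ : Measure Ω}
    [IsProbabilityMeasure μ] {d : ℕ} {θ : Ω ≃ᵐ Ω} {φ : Ω → Mat d →ₗ[ℂ] Mat d} (hd : 1 ≤ d)
    (hΦ : IsErgodicQuantumProcess μ θ φ) :
    ∃ ρ : Ω → Mat d, MeasurableMat ρ ∧ (∀ᵐ ω ∂μ, (ρ ω).PosSemidef) ∧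
      (∀ᵐ ω ∂μ, (ρ ω).trace = 1) ∧ ∀ᵐ ω ∂μ, φ (θ ω) (ρ ω) = ρ (θ ω) := by
  set V := matEuclidean d with hV
  have hVm : ∀ x : Ω → EuclideanSpace ℂ (Fin d × Fin d), Measurable x →
      MeasurableMat fun ω => V (x ω) := fun x hx i j =>
    (show Continuous fun v : EuclideanSpace ℂ (Fin d × Fin d) => v (i, j) by
      fun_prop).measurable.comp hx
  have hVm' : ∀ y : Ω → Mat d, MeasurableMat y → Measurable fun ω => V.symm (y ω) := by
    intro y hy
    have h1 : Measurable fun ω => (fun p => y ω p.1 p.2 : Fin d × Fin d → ℂ) :=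
      measurable_pi_iff.2 fun p => hy p.1 p.2
    exact (MeasurableEquiv.toLp 2 (Fin d × Fin d → ℂ)).measurable.comp h1
  have hVc : Continuous V := LinearMap.continuous_of_finiteDimensional V.toLinearMap
  set L : Ω → EuclideanSpace ℂ (Fin d × Fin d) →ₗ[ℝ] EuclideanSpace ℂ (Fin d × Fin d) :=
    fun ω => (V.symm.toLinearMap ∘ₗ φ ω ∘ₗ V.toLinearMap).restrictScalars ℝ with hLdef
  obtain ⟨A, hA⟩ := exists_continuousLinearMap_Lp_ae_eq (μ := μ) L
    (fun x hx => (hVm' _ (MeasurableMat.apply hΦ.measurable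
      (hVm x hx.measurable))).stronglyMeasurable)
    (fun ω v => (hΦ.channel ω).norm_euclidean_le v)
  have hθ := hΦ.ergodic.toMeasurePreserving
  have hθs : MeasurePreserving θ.symm μ μ := hθ.symm θ
  -- A fixed point of `T` satisfies `x ω = φ ω (x (θ⁻¹ ω))`, which is stationarity after replacing
  -- `ω` by `θ ω`.
  set T := A.comp (Lp.compMeasurePreservingₗᵢ ℝ θ.symm hθs).toContinuousLinearMap with hT
  have hTx : ∀ x, T x =ᵐ[μ] fun ω => V.symm (φ ω (V (x (θ.symm ω)))) := by
    intro x
    have h := hA (Lp.compMeasurePreservingₗᵢ ℝ θ.symm hθs x)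
    filter_upwards [h, Lp.coeFn_compMeasurePreserving x hθs] with ω h1 h2
    refine h1.trans ?_
    rw [show (Lp.compMeasurePreservingₗᵢ ℝ θ.symm hθs x : Ω → _) ω = x (θ.symm ω) from h2]
    rfl
  set S : Set (EuclideanSpace ℂ (Fin d × Fin d)) :=
    {v | (V v).PosSemidef ∧ (V v).trace = 1} with hS
  have hScl : IsClosed S := ((isClosed_posSemidef d).preimage hVc).inter
    (isClosed_eq (show Continuous fun v => (V v).trace by fun_prop) continuous_const)
  have hSconv : Convex ℝ S := by
    intro v hv w hw a b ha hb hab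
    have h1 : V (a • v + b • w) = a • V v + b • V w := by
      rw [map_add, LinearMap.map_smul_of_tower V.toLinearMap a v |> (fun h => (h : V (a • v) = _)),
        LinearMap.map_smul_of_tower V.toLinearMap b w |> (fun h => (h : V (b • w) = _))]
      rfl
    refine ⟨?_, ?_⟩
    · rw [h1]
      exact (hv.1.smul ha).add (hw.1.smul hb)
    · rw [h1, Matrix.trace_add, Matrix.trace_smul, Matrix.trace_smul, hv.2, hw.2, ← add_smul,
        hab, one_smul]
  have hSb : ∀ v ∈ S, ‖v‖ ≤ d * 1 := fun v hv =>
    norm_euclidean_le_of_forall zero_le_one fun p => by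
      have h := hv.1.norm_apply_le_trace p.1 p.2
      rwa [hv.2, Complex.one_re] at h
  set K : Set (Lp (EuclideanSpace ℂ (Fin d × Fin d)) 2 μ) := {x | ∀ᵐ ω ∂μ, x ω ∈ S} with hK
  have hKne : K.Nonempty := by
    have hd0 : (d : ℂ) ≠ 0 := by exact_mod_cast (by omega : d ≠ 0)
    have hc : V.symm ((d : ℂ)⁻¹ • (1 : Mat d)) ∈ S := by
      refine ⟨?_, ?_⟩
      · rw [LinearEquiv.apply_symm_apply]
        exact Matrix.PosSemidef.one.smul (by positivity)
      · rw [LinearEquiv.apply_symm_apply, Matrix.trace_smul, Matrix.trace_one, Fintype.card_fin,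
          smul_eq_mul, inv_mul_cancel₀ hd0]
    refine ⟨(memLp_const (V.symm ((d : ℂ)⁻¹ • (1 : Mat d)))).toLp, ?_⟩
    filter_upwards [(memLp_const (μ := μ) (p := 2)
      (V.symm ((d : ℂ)⁻¹ • (1 : Mat d)))).coeFn_toLp] with ω h
    rw [h]
    exact hc
  have hKconv : Convex ℝ K := by
    intro y hy z hz a b ha hb hab
    filter_upwards [hy, hz, Lp.coeFn_add (a • y) (b • z), Lp.coeFn_smul a y,
      Lp.coeFn_smul b z] with ω h1 h2 h3 h4 h5
    rw [h3, Pi.add_apply, h4, h5]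
    exact hSconv h1 h2 ha hb hab
  have hKb : Bornology.IsBounded K := by
    refine (Metric.isBounded_closedBall (x := 0)
      (r := (measureUnivNNReal μ : ℝ) ^ (2 : ENNReal).toReal⁻¹ * (d * 1))).subset fun y hy => ?_
    rw [mem_closedBall_zero_iff]
    exact Lp.norm_le_of_ae_bound (by positivity) ((show ∀ᵐ ω ∂μ, y ω ∈ S from hy).mono fun ω h => hSb _ h)
  have hKT : Set.MapsTo T K K := by
    intro y hy
    filter_upwards [hTx y, hθs.quasiMeasurePreserving.ae hy] with ω h1 h2
    rw [h1]
    refine ⟨?_, ?_⟩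
    · rw [LinearEquiv.apply_symm_apply]
      exact (hΦ.channel ω).completelyPositive.posSemidef h2.1
    · rw [LinearEquiv.apply_symm_apply, (hΦ.channel ω).trace_preserving, h2.2]
  obtain ⟨x, hxK, hx⟩ := T.exists_fixedPoint_of_mapsTo hKne (isClosed_setOf_ae_mem hScl) hKconv hKb
    hKT
  have hxS : ∀ᵐ ω ∂μ, x ω ∈ S := hxK
  refine ⟨fun ω => V (x ω), hVm _ (Lp.stronglyMeasurable x).measurable,
    hxS.mono fun _ h => h.1, hxS.mono fun _ h => h.2, ?_⟩
  have h1 : ∀ᵐ ω ∂μ, x ω = V.symm (φ ω (V (x (θ.symm ω)))) := by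
    have h := hTx x
    rwa [hx] at h
  filter_upwards [hΦ.ae_comp h1] with ω h2
  rw [h2, LinearEquiv.apply_symm_apply, MeasurableEquiv.symm_apply_apply]

theorem IsIrreducibleProcess.exists_isStationaryState {Ω : Type u} [MeasurableSpace Ω]
    {μ : Measure Ω} [IsProbabilityMeasure μ] {d : ℕ} {θ : Ω ≃ᵐ Ω} {φ : Ω → Mat d →ₗ[ℂ] Mat d}
    (hd : 1 ≤ d) (hΦ : IsErgodicQuantumProcess μ θ φ) (hirr : IsIrreducibleProcess μ θ φ) :
    ∃ ρ, IsStationaryState μ θ φ ρ := by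
  obtain ⟨ρ, hm, hpos, htr, hfix⟩ := exists_invariant_state hd hΦ
  refine ⟨ρ, hm, hirr.ae_posDef hΦ hm hpos hfix fun h => ?_, htr, hfix⟩
  obtain ⟨ω, h1, h2⟩ := (h.and htr).exists
  simp [h1] at h2

/-! ### Weak mixing -/

section WeakMixing

variable {Ω : Type u} [MeasurableSpace Ω] {μ : Measure Ω} {θ : Ω ≃ᵐ Ω}

/-- The correlation of `f ∘ θ ^ n` with the indicator of `B`. -/
noncomputable def correlation (μ : Measure Ω) (θ : Ω ≃ᵐ Ω) (B : Set Ω) (f : Ω → ℂ) (n : ℕ) : ℂ :=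
  ∫ ω in B, f (θ^[n] ω) ∂μ - (∫ ω, f ω ∂μ) * μ.real B

theorem integral_comp_iterate (hθ : MeasurePreserving θ μ μ) (n : ℕ) (f : Ω → ℂ) :
    ∫ ω, f (θ^[n] ω) ∂μ = ∫ ω, f ω ∂μ := by
  induction n with
  | zero => rfl
  | succ n ih =>
    simp only [Function.iterate_succ_apply]
    exact (hθ.integral_comp' (fun ω => f (θ^[n] ω))).trans ih

theorem correlation_add (hθ : MeasurePreserving θ μ μ) (B : Set Ω) {f g : Ω → ℂ}
    (hf : Integrable f μ) (hg : Integrable g μ) (n : ℕ) :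
    correlation μ θ B (f + g) n = correlation μ θ B f n + correlation μ θ B g n := by
  have h1 : Integrable (fun ω => f (θ^[n] ω)) μ := (hθ.iterate n).integrable_comp_of_integrable hf
  have h2 : Integrable (fun ω => g (θ^[n] ω)) μ := (hθ.iterate n).integrable_comp_of_integrable hg
  simp only [correlation, Pi.add_apply]
  rw [integral_add h1.integrableOn h2.integrableOn, integral_add hf hg]
  ring

variable [IsProbabilityMeasure μ]

theorem norm_correlation_le (hθ : MeasurePreserving θ μ μ) (B : Set Ω) {f : Ω → ℂ}
    (hf : Integrable f μ) (n : ℕ) : ‖correlation μ θ B f n‖ ≤ 2 * ∫ ω, ‖f ω‖ ∂μ := by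
  have h1 : Integrable (fun ω => ‖f (θ^[n] ω)‖) μ :=
    ((hθ.iterate n).integrable_comp_of_integrable hf).norm
  have h2 : ‖∫ ω in B, f (θ^[n] ω) ∂μ‖ ≤ ∫ ω, ‖f ω‖ ∂μ := by
    refine (norm_integral_le_integral_norm _).trans ?_
    refine (setIntegral_le_integral h1 (ae_of_all _ fun _ => norm_nonneg _)).trans_eq ?_
    have h := integral_comp_iterate hθ n fun ω => ((‖f ω‖ : ℝ) : ℂ)
    simp only [integral_complex_ofReal] at h
    exact_mod_cast h
  have h3 : ‖(∫ ω, f ω ∂μ) * μ.real B‖ ≤ ∫ ω, ‖f ω‖ ∂μ := by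
    rw [norm_mul, Complex.norm_real, Real.norm_of_nonneg measureReal_nonneg]
    exact (mul_le_of_le_one_right (norm_nonneg _) measureReal_le_one).trans
      (norm_integral_le_integral_norm _)
  refine (norm_sub_le _ _).trans ?_
  linarith

/-- For indicators this is the definition of weak mixing. It passes to sums and `L¹` limits because
correlations are bounded by `2 ‖f‖₁` uniformly in `n`. -/
theorem IsWeaklyMixing.tendsto_correlation (hθ : MeasurePreserving θ μ μ)
    (hmix : IsWeaklyMixing μ θ) {B : Set Ω} (hB : MeasurableSet B) {f : Ω → ℂ}
    (hf : Integrable f μ) :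
    Tendsto (fun N : ℕ => (N : ℝ)⁻¹ * ∑ n ∈ Finset.Icc 1 N, ‖correlation μ θ B f n‖)
      atTop (𝓝 0) := by
  have hnn : ∀ (f : Ω → ℂ) (N : ℕ),
      0 ≤ (N : ℝ)⁻¹ * ∑ n ∈ Finset.Icc 1 N, ‖correlation μ θ B f n‖ := fun f N =>
    mul_nonneg (by positivity) (Finset.sum_nonneg fun _ _ => norm_nonneg _)
  have hsub : ∀ {f g : Ω → ℂ}, Integrable f μ → Integrable g μ → ∀ N : ℕ,
      (N : ℝ)⁻¹ * ∑ n ∈ Finset.Icc 1 N, ‖correlation μ θ B (f + g) n‖ ≤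
      (N : ℝ)⁻¹ * ∑ n ∈ Finset.Icc 1 N, ‖correlation μ θ B f n‖ +
      (N : ℝ)⁻¹ * ∑ n ∈ Finset.Icc 1 N, ‖correlation μ θ B g n‖ := by
    intro f g hf hg N
    rw [← mul_add, ← Finset.sum_add_distrib]
    refine mul_le_mul_of_nonneg_left (Finset.sum_le_sum fun n _ => ?_) (by positivity)
    rw [correlation_add hθ B hf hg]
    exact norm_add_le _ _
  refine Integrable.induction
    (fun f => Tendsto (fun N : ℕ => (N : ℝ)⁻¹ * ∑ n ∈ Finset.Icc 1 N, ‖correlation μ θ B f n‖)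
      atTop (𝓝 0)) ?_ ?_ ?_ ?_ hf
  · intro c A hA _
    have h1 : ∀ n, ‖correlation μ θ B (A.indicator fun _ => c) n‖ =
        ‖c‖ * |μ.real ((θ^[n]) ⁻¹' A ∩ B) - μ.real A * μ.real B| := by
      intro n
      have hAn : MeasurableSet ((θ^[n]) ⁻¹' A) := (hθ.iterate n).measurable hA
      have h2 : ∀ ω, A.indicator (fun _ => c) (θ^[n] ω) =
          ((θ^[n]) ⁻¹' A).indicator (fun _ => c) ω := fun ω => rfl
      simp only [correlation, h2]
      rw [integral_indicator_const _ hA, integral_indicator_const _ hAn,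
        measureReal_restrict_apply hAn, ← Real.norm_eq_abs, ← Complex.norm_real, ← norm_mul]
      congr 1
      simp only [Complex.real_smul]
      push_cast
      ring
    simp only [h1, ← Finset.mul_sum]
    have h3 := (hmix A B hA hB).const_mul ‖c‖
    rw [mul_zero] at h3
    refine h3.congr fun N => ?_
    ring
  · intro f g _ hf hg h1 h2
    have h3 := h1.add h2
    rw [add_zero] at h3
    exact squeeze_zero (hnn _) (hsub hf hg) h3
  · refine IsSeqClosed.isClosed fun F G hF hFG => ?_
    rw [Set.mem_ofPred_eq, Metric.tendsto_atTop]
    intro ε hε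
    -- The approximation error contributes at most `2 * (ε / 4)`, so the total stays below `3 ε /
    -- 4`.
    obtain ⟨k, hk⟩ := ((Metric.tendsto_nhds.1 hFG) (ε / 4) (by positivity)).exists
    obtain ⟨N₀, hN₀⟩ := (Metric.tendsto_atTop.1 (hF k)) (ε / 4) (by positivity)
    refine ⟨N₀, fun N hN => ?_⟩
    have hN1 := hN₀ N hN
    rw [Real.dist_0_eq_abs, abs_of_nonneg (hnn _ N)] at hN1 ⊢
    have hFi : Integrable (F k) μ := L1.integrable_coeFn _
    have hGi : Integrable G μ := L1.integrable_coeFn _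
    have hdiff : ∫ ω, ‖(G - F k : Ω → ℂ) ω‖ ∂μ < ε / 4 := by
      rw [dist_comm, dist_eq_norm, L1.norm_eq_integral_norm] at hk
      refine lt_of_eq_of_lt (integral_congr_ae ?_) hk
      filter_upwards [Lp.coeFn_sub G (F k)] with ω h
      rw [h]
    have h1 := hsub hFi (hGi.sub hFi) N
    rw [add_sub_cancel] at h1
    have h2 : (N : ℝ)⁻¹ * ∑ n ∈ Finset.Icc 1 N, ‖correlation μ θ B (G - F k : Ω → ℂ) n‖ ≤
        ε / 2 := by
      have h3 : ∑ n ∈ Finset.Icc 1 N, ‖correlation μ θ B (G - F k : Ω → ℂ) n‖ ≤ N * (ε / 2) := by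
        refine (Finset.sum_le_card_nsmul _ _ (ε / 2) fun n _ => ?_).trans_eq ?_
        · exact (norm_correlation_le hθ B (hGi.sub hFi) n).trans (by linarith)
        · rw [Nat.card_Icc, nsmul_eq_mul, Nat.add_sub_cancel]
      rcases N.eq_zero_or_pos with rfl | hNpos
      · simp; positivity
      · rw [inv_mul_le_iff₀ (by exact_mod_cast hNpos)]
        exact h3
    linarith
  · intro f g hfg _ h
    refine h.congr fun N => ?_
    have h1 : ∀ n, correlation μ θ B f n = correlation μ θ B g n := by
      intro n
      simp only [correlation]
      have h2 : (fun ω => f (θ^[n] ω)) =ᵐ[μ] fun ω => g (θ^[n] ω) :=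
        (hθ.iterate n).quasiMeasurePreserving.ae hfg
      rw [integral_congr_ae hfg, integral_congr_ae (ae_restrict_of_ae h2)]
    simp only [h1]

/-- If `β ≠ 1`, invariance of the integral gives `∫ f = 0`, so the correlation with `B` is `β ^ n
∫_B f`, of modulus independent of `n`. Its averages tend to zero, so `∫_B f = 0` for every `B` and
`f = 0`. -/
theorem IsWeaklyMixing.eq_one_of_mem_koopmanEigenvalues (hθ : Ergodic θ μ)
    (hmix : IsWeaklyMixing μ θ) {β : ℂ} (hβ : β ∈ koopmanEigenvalues μ θ) : β = 1 := by
  have hβ1 := norm_eq_one_of_mem_koopmanEigenvalues hθ hβ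
  obtain ⟨f, hf, hf0, hfβ⟩ := hβ
  by_contra hne
  obtain ⟨c, hc⟩ := hθ.ae_eq_const_of_comp_ae_le hf.norm (by
    filter_upwards [hfβ] with ω h
    rw [h, norm_mul, hβ1, one_mul])
  have hfi : Integrable f μ := Integrable.of_bound hf.aestronglyMeasurable c
    (hc.mono fun _ h => h.le)
  have hint : ∫ ω, f ω ∂μ = 0 := by
    have h1 := integral_comp_iterate hθ.toMeasurePreserving 1 f
    simp only [Function.iterate_one] at h1
    rw [integral_congr_ae hfβ, integral_const_mul] at h1
    have h2 : (β - 1) * ∫ ω, f ω ∂μ = 0 := by rw [sub_mul, h1, one_mul, sub_self]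
    exact (mul_eq_zero.1 h2).resolve_left (sub_ne_zero.2 hne)
  have hiter : ∀ n : ℕ, ∀ᵐ ω ∂μ, f (θ^[n] ω) = β ^ n * f ω := by
    intro n
    induction n with
    | zero => exact ae_of_all _ fun ω => by simp
    | succ n ih =>
      filter_upwards [ih, (hθ.toMeasurePreserving.iterate n).quasiMeasurePreserving.ae hfβ]
        with ω h1 h2
      rw [Function.iterate_succ_apply', h2, h1, pow_succ']
      ring
  have hzero : ∀ B, MeasurableSet B → μ B < ⊤ → ∫ ω in B, f ω ∂μ = 0 := by
    intro B hB _
    have hcorr : ∀ n, ‖correlation μ θ B f n‖ = ‖∫ ω in B, f ω ∂μ‖ := by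
      intro n
      rw [correlation, hint, zero_mul, sub_zero, integral_congr_ae (ae_restrict_of_ae (hiter n)),
        integral_const_mul, norm_mul, norm_pow, hβ1, one_pow, one_mul]
    have h1 := hmix.tendsto_correlation hθ.toMeasurePreserving hB hfi
    simp only [hcorr, Finset.sum_const, Nat.card_Icc, Nat.add_sub_cancel, nsmul_eq_mul] at h1
    have h2 : Tendsto (fun N : ℕ => (N : ℝ)⁻¹ * (N * ‖∫ ω in B, f ω ∂μ‖)) atTop
        (𝓝 ‖∫ ω in B, f ω ∂μ‖) := by
      refine tendsto_const_nhds.congr' ?_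
      filter_upwards [eventually_ge_atTop 1] with N hN
      rw [inv_mul_cancel_left₀]
      exact_mod_cast (by omega : N ≠ 0)
    exact norm_eq_zero.1 (tendsto_nhds_unique h2 h1)
  exact hf0 (hfi.ae_eq_zero_of_forall_setIntegral_eq_zero hzero)

end WeakMixing

/-! ### The cyclic shift channel -/

section Shift

variable {d : ℕ}

theorem shiftChannel_apply (a : Mat d) :
    shiftChannel d a = Matrix.diagonal fun i => a (finRotate d i) (finRotate d i) := by
  show ∑ i : Fin d, _ = _
  ext k l
  rw [Matrix.sum_apply]
  simp only [Matrix.conjTranspose_single, star_one, Matrix.single_mul_mul_single, one_mul, mul_one,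
    Matrix.single_apply, Matrix.diagonal_apply]
  by_cases h : k = l
  · subst h
    simp
  · rw [if_neg h]
    refine Finset.sum_eq_zero fun i _ => if_neg ?_
    rintro ⟨rfl, rfl⟩
    exact h rfl

theorem isQuantumChannel_shiftChannel : IsQuantumChannel (shiftChannel d) := by
  refine ⟨fun k X hX => ?_, fun a => ?_⟩
  -- This is the Kraus form of the amplification, with operators `v_i ⊗ 1`.
  · have h : amplify (shiftChannel d) k X = ∑ i : Fin d,
        (Matrix.of fun (a b : Fin d × Fin k) =>
          if a.1 = i ∧ b = (finRotate d i, a.2) then (1 : ℂ) else 0) * X *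
        (Matrix.of fun (a b : Fin d × Fin k) =>
          if a.1 = i ∧ b = (finRotate d i, a.2) then (1 : ℂ) else 0)ᴴ := by
      ext a b
      rw [Matrix.sum_apply]
      simp only [amplify, shiftChannel_apply, Matrix.of_apply, Matrix.diagonal_apply,
        Matrix.mul_apply, Matrix.conjTranspose_apply, ite_and, apply_ite star, star_one, star_zero,
        mul_ite, ite_mul, one_mul, mul_one, zero_mul, mul_zero, Finset.sum_ite_eq',
        Finset.mem_univ, if_true, Finset.sum_ite_irrel, Finset.sum_const_zero]
      rw [Finset.sum_ite_eq]
      by_cases h : a.1 = b.1 <;> simp [h]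
    rw [h]
    exact Matrix.posSemidef_sum _ fun i _ => hX.mul_mul_conjTranspose_same _
  · rw [shiftChannel_apply, Matrix.trace_diagonal]
    exact Equiv.sum_comp (finRotate d) fun i => a i i

theorem ae_dirac_unit {P : Unit → Prop} :
    (∀ᵐ ω ∂(Measure.dirac () : Measure Unit), P ω) ↔ P () := by
  rw [ae_dirac_eq]
  rfl

theorem isErgodicQuantumProcess_of_channel {ψ : Mat d →ₗ[ℂ] Mat d} (hψ : IsQuantumChannel ψ) :
    IsErgodicQuantumProcess (Measure.dirac ()) (MeasurableEquiv.refl Unit) fun _ => ψ := by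
  refine ⟨⟨MeasurePreserving.id _, ⟨fun s _ _ => ?_⟩⟩, fun a => MeasurableMat.const _,
    fun _ => hψ⟩
  rw [eventuallyConst_set]
  by_cases h : () ∈ s
  · exact Or.inl (ae_dirac_unit.2 h)
  · exact Or.inr (ae_dirac_unit.2 h)

theorem Fin.ofNat_succ_eq_add_one (m n : ℕ) :
    Fin.ofNat (m + 1) (n + 1) = Fin.ofNat (m + 1) n + 1 := by
  ext
  simp [Fin.ofNat, Fin.val_add]

/-- A reducing `p` fixes the diagonal matrix `ψ p` from the left, so `p (i+1) (i+1) ≠ 0` forces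
column `i` of `p` to be that of the identity. A nonzero diagonal entry exists as `p ≠ 0`, and this
propagates backwards around the whole cycle. -/
theorem isIrreducibleProcess_shiftChannel (hd : 1 ≤ d) :
    IsIrreducibleProcess (Measure.dirac ()) (MeasurableEquiv.refl Unit)
      fun _ => shiftChannel d := by
  obtain ⟨m, rfl⟩ : ∃ m, d = m + 1 := ⟨d - 1, by omega⟩
  intro q hq hred
  have hstar : IsStarProjection (q ()) := ae_dirac_unit.1 hq.isStarProjection
  have hne : q () ≠ 0 := fun h => hq.ne_zero (ae_dirac_unit.2 h)
  have hred' : shiftChannel (m + 1) '' corner (q ()) ⊆ corner (q ()) := ae_dirac_unit.1 hred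
  rw [ae_dirac_unit]
  generalize q () = p at hstar hne hred'
  have hpp : p * p = p := hstar.1
  have hpstar : pᴴ = p := hstar.2
  obtain ⟨a, ha⟩ := hred' ⟨p, ⟨p, by rw [hpp, hpp]⟩, rfl⟩
  have hpD : p * shiftChannel (m + 1) p = shiftChannel (m + 1) p := by
    rw [ha, ← Matrix.mul_assoc, ← Matrix.mul_assoc, hpp]
  rw [shiftChannel_apply] at hpD
  have hcol : ∀ i, p (i + 1) (i + 1) ≠ 0 → ∀ k, p k i = if k = i then 1 else 0 := by
    intro i hi k
    have h := congrFun (congrFun hpD k) i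
    rw [Matrix.mul_diagonal, Matrix.diagonal_apply, finRotate_apply] at h
    by_cases hk : k = i
    · subst hk
      rw [if_pos rfl, finRotate_apply] at h
      rw [if_pos rfl]
      exact mul_right_cancel₀ hi (by rw [h, one_mul])
    · rw [if_neg hk] at h
      rw [if_neg hk]
      exact (mul_eq_zero.1 h).resolve_right hi
  obtain ⟨j, hj⟩ : ∃ j, p j j ≠ 0 := by
    by_contra! h
    refine hne ((Matrix.trace_conjTranspose_mul_self_eq_zero_iff).1 ?_)
    rw [hpstar, hpp]
    exact Finset.sum_eq_zero fun i _ => h i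
  have hall : ∀ n : ℕ, p (j - Fin.ofNat (m + 1) n) (j - Fin.ofNat (m + 1) n) ≠ 0 := by
    intro n
    induction n with
    | zero => simpa using hj
    | succ n ih =>
      have h := hcol (j - Fin.ofNat (m + 1) (n + 1)) (by
        rw [Fin.ofNat_succ_eq_add_one, sub_add_eq_sub_sub, sub_add_cancel]; exact ih)
        (j - Fin.ofNat (m + 1) (n + 1))
      rw [h, if_pos rfl]
      exact one_ne_zero
  ext k i
  rw [hcol i ?_ k, Matrix.one_apply]
  have h := hall (j - (i + 1) : Fin (m + 1)).val
  rwa [Fin.ofNat_val_eq_self, sub_sub_cancel] at h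

theorem koopmanEigenvalues_unit :
    koopmanEigenvalues (Measure.dirac ()) (MeasurableEquiv.refl Unit) = {1} := by
  ext β
  simp only [koopmanEigenvalues, ae_dirac_unit, Set.mem_ofPred_eq, Set.mem_singleton_iff]
  constructor
  · rintro ⟨f, -, h0, h1⟩
    exact (mul_eq_right₀ h0).1 (Eq.symm h1)
  · rintro rfl
    exact ⟨fun _ => 1, measurable_const, one_ne_zero, (one_mul _).symm⟩

/-- An eigenmatrix is diagonal and each step along the cycle multiplies its entries by `α`; a full
turn forces `α ^ d = 1`. Conversely, `diag (α ^ i)` is an eigenmatrix, the wrap-around entry using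
`α ^ d = 1`. -/
theorem peripheralEigenvalues_shiftChannel (hd : 1 ≤ d) :
    peripheralEigenvalues (Measure.dirac ()) (MeasurableEquiv.refl Unit)
      (fun _ => shiftChannel d) = {α | α ^ d = 1} := by
  obtain ⟨m, rfl⟩ : ∃ m, d = m + 1 := ⟨d - 1, by omega⟩
  ext α
  simp only [peripheralEigenvalues, ae_dirac_unit, Set.mem_ofPred_eq, shiftChannel_apply]
  constructor
  · rintro ⟨hα, x, -, h0, h1⟩
    have hα0 : α ≠ 0 := by rintro rfl; simp at hα
    change Matrix.diagonal _ = α • x () at h1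
    generalize x () = y at h0 h1
    have hstep : ∀ i, y (i + 1) (i + 1) = α * y i i := by
      intro i
      have h := congrFun (congrFun h1 i) i
      rwa [Matrix.diagonal_apply_eq, finRotate_apply] at h
    have hoff : ∀ i j, i ≠ j → y i j = 0 := by
      intro i j hij
      have h := congrFun (congrFun h1 i) j
      rw [Matrix.diagonal_apply_ne _ hij, Matrix.smul_apply, smul_eq_mul] at h
      exact (mul_eq_zero.1 h.symm).resolve_left hα0
    obtain ⟨i, hi⟩ : ∃ i, y i i ≠ 0 := by
      by_contra! h
      refine h0 (Matrix.ext fun i j => ?_)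
      by_cases hij : i = j
      · subst hij; exact h i
      · exact hoff i j hij
    have hpow : ∀ n : ℕ, y (i + Fin.ofNat (m + 1) n) (i + Fin.ofNat (m + 1) n) = α ^ n * y i i := by
      intro n
      induction n with
      | zero => simp
      | succ n ih => rw [Fin.ofNat_succ_eq_add_one, ← add_assoc, hstep, ih, pow_succ']; ring
    have h := hpow (m + 1)
    rw [Fin.ofNat_self, add_zero] at h
    exact (mul_eq_right₀ hi).1 h.symm
  · intro hα
    refine ⟨Complex.norm_eq_one_of_pow_eq_one hα (Nat.succ_ne_zero m),
      fun _ => Matrix.diagonal fun i => α ^ i.val, MeasurableMat.const _, fun h => ?_, ?_⟩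
    · have h1 := congrFun (congrFun h 0) 0
      simp at h1
    · change Matrix.diagonal (fun i => Matrix.diagonal (fun j : Fin (m + 1) => α ^ j.val)
        (finRotate _ i) (finRotate _ i)) = α • Matrix.diagonal _
      rw [← Matrix.diagonal_smul]
      congr 1
      ext i
      rw [Matrix.diagonal_apply_eq, finRotate_apply, Pi.smul_apply, smul_eq_mul, ← pow_succ',
        Fin.val_add_one]
      split_ifs with hi
      · rw [hi, Fin.val_last, pow_zero, hα]
      · rfl

end Shift

/-! ### The corollary and its sharpness -/

theorem mainTheorem5 (d : ℕ) (hd : 1 ≤ d) :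
    (∀ (Ω : Type u) [MeasurableSpace Ω] (μ : Measure Ω) [IsProbabilityMeasure μ]
        (θ : Ω ≃ᵐ Ω) (φ : Ω → Mat d →ₗ[ℂ] Mat d),
        IsErgodicQuantumProcess μ θ φ → IsIrreducibleProcess μ θ φ →
        (IsTorsionSet (koopmanEigenvalues μ θ) →
          ∃ G H : Subgroup ℂˣ,
            IsSubgroupOfUnits G (peripheralEigenvalues μ θ φ) ∧
            IsSubgroupOfUnits H (koopmanEigenvalues μ θ) ∧
            H ≤ G ∧
            IsCyclic (G ⧸ H.subgroupOf G) ∧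
            Finite (G ⧸ H.subgroupOf G) ∧
            Nat.card (G ⧸ H.subgroupOf G) ≤ d) ∧
        (IsWeaklyMixing μ θ → IsTorsionSet (koopmanEigenvalues μ θ))) ∧
    (IsErgodicQuantumProcess (Measure.dirac ()) (MeasurableEquiv.refl Unit)
        (fun _ => shiftChannel d) ∧
      IsIrreducibleProcess (Measure.dirac ()) (MeasurableEquiv.refl Unit)
        (fun _ => shiftChannel d) ∧
      IsTorsionSet (koopmanEigenvalues (Measure.dirac ()) (MeasurableEquiv.refl Unit)) ∧
      ∃ G H : Subgroup ℂˣ,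
        IsSubgroupOfUnits G (peripheralEigenvalues (Measure.dirac ()) (MeasurableEquiv.refl Unit)
          (fun _ => shiftChannel d)) ∧
        IsSubgroupOfUnits H
          (koopmanEigenvalues (Measure.dirac ()) (MeasurableEquiv.refl Unit)) ∧
        H ≤ G ∧
        IsCyclic (G ⧸ H.subgroupOf G) ∧
        Nat.card (G ⧸ H.subgroupOf G) = d) := by
  refine ⟨fun Ω _ μ _ θ φ hΦ hirr => ⟨fun htor => ?_, fun hmix β hβ => ?_⟩,
    isErgodicQuantumProcess_of_channel isQuantumChannel_shiftChannel,
    isIrreducibleProcess_shiftChannel hd, ?_, ?_⟩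
  · obtain ⟨ρ, hρ⟩ := hirr.exists_isStationaryState hd hΦ
    exact exists_subgroups_of_isStationaryState hd hΦ hirr hρ htor
  · exact ⟨1, one_pos, by
      rw [hmix.eq_one_of_mem_koopmanEigenvalues hΦ.ergodic hβ, one_pow]⟩
  · rw [koopmanEigenvalues_unit]
    rintro β rfl
    exact ⟨1, one_pos, one_pow 1⟩
  · have : NeZero d := ⟨by omega⟩
    refine ⟨rootsOfUnity d ℂ, ⊥, ?_, ?_, bot_le, inferInstance, ?_⟩
    · rw [peripheralEigenvalues_shiftChannel hd]
      ext α
      constructor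
      · rintro ⟨u, hu, rfl⟩
        have h : u ^ d = 1 := hu
        simpa using congrArg Units.val h
      · intro hα
        have hα0 : α ≠ 0 := by
          rintro rfl
          rw [Set.mem_ofPred_eq, zero_pow (by omega)] at hα
          exact zero_ne_one hα
        exact ⟨Units.mk0 α hα0, (show _ ^ d = 1 from Units.ext (by simpa using hα)), rfl⟩
    · rw [koopmanEigenvalues_unit, IsSubgroupOfUnits, Subgroup.coe_bot, Set.image_singleton,
        Units.val_one]
    · rw [Subgroup.bot_subgroupOf,
        Nat.card_congr (QuotientGroup.quotientBot (G := rootsOfUnity d ℂ)).toEquiv]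
      exact Complex.card_rootsOfUnity d
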